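/- Let $\mathbf v_0=(1,0)$, $\mathbf v_1=(-\tfrac12,\tfrac{\sqrt3}2)$, $\mathbf v_2=(-\tfrac12,-\tfrac{\sqrt3}2)$, let $\Lambda\subset\mathbb R^2$ be the Eisenstein lattice they generate, and let $\Lambda_{\mathrm{vis}}=\{\mathbf w\in\Lambda: c\mathbf w\notin\Lambda \text{ for all real } 0<c<1\}$. For $\mathbf v\in\mathbb R^2$ put $\|\mathbf v\|_{\mathrm{hex}}=\min\{|a|+|b|+|c| : a,b,c\in\mathbb R,\ \mathbf v=a\mathbf v_0+b\mathbf v_1+c\mathbf v_2\}$ (an integer for $\mathbf v\in\Lambda$), and define two sets of directions in $S^1$ by $$\mathcal D=\Big\{\tfrac{\mathbf w}{|\mathbf w|}: \mathbf w\in\Lambda_{\mathrm{vis}},\ \|\mathbf w\|_{\mathrm{hex}}\equiv 0 \!\!\pmod 3\Big\},\qquad \mathcal P=\Big\{\tfrac{\mathbf w}{|\mathbf w|}: \mathbf w\in\Lambda_{\mathrm{vis}},\ \|\mathbf w\|_{\mathrm{hex}}\not\equiv 0 \!\!\pmod 3\Big\}.$$ Consider the trihexagonal tiling of the plane with unit edges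 whose hexagons are centered at the points of $2\Lambda$ and have vertices $\mathbf c\pm\mathbf v_i$ ($\mathbf c\in2\Lambda$, $i=0,1,2$). The refractive flow $T$ on the unit tangent bundle $X=\mathbb R^2\times S^1$ moves a unit vector at unit speed along a straight line inside each tile; when it crosses the interior of an edge, its direction is replaced by the opposite of its reflection across that edge (refraction coefficient $-1$). Vertices of the tiling are singularities, through which trajectories are not defined; a trajectory is non-singular if it is defined for all time. For $\theta\in S^1$ and a sign $s\in\{+,-\}$, let $X_{\theta,s}\subset X$ be the set of unit vectors whose trajectory, whenever it is inside a hexagon, travels in a direction in $\{\theta,\theta+\frac{2\pi}3,\theta+\frac{4\pi}3\}$ and travels counterclockwise ($s=+$), respectively clockwise ($s=-$), around the center of that hexagon. Let $T_{\theta,s}$ be the restriction of $T$ to $X_{\theta,s}$. A non-singular trajectory is called drift-periodic if it is invariant under a non-trivial translational symmetry of the tiling. **Theorem.** 1. If $\theta\in\mathcal P$, then $T_{\theta,+}$ and $T_{\theta,-}$ are completely periodic, i.e. each of their non-singular trajectories is periodic. Conversely, every periodic trajectory of $T$ is contained in $X_{\theta,+}$ or $X_{\theta,-}$ for some $\theta\in\mathcal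 P$. 2. If $\theta\in\mathcal D$, then $T_{\theta,+}$ and $T_{\theta,-}$ are completely drift-periodic, i.e. each of their non-singular trajectories is drift-periodic. Conversely, every drift-periodic trajectory of $T$ is contained in $X_{\theta,+}$ or $X_{\theta,-}$ for some $\theta\in\mathcal D$. -/

import Mathlib

open Set Filter Topology

noncomputable section

namespace Trihex

/-! The Euclidean plane is `ℂ`; directions are points of the unit circle `Circle`. -/

/-- The vectors `v₀ = (1, 0)`, `v₁ = (-1/2, √3/2)`, `v₂ = (-1/2, -√3/2)`. -/
def v : Fin 3 → ℂ :=
  ![⟨1, 0⟩, ⟨-(1 / 2), Real.sqrt 3 / 2⟩, ⟨-(1 / 2), -(Real.sqrt 3 / 2)⟩]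

/-- The Eisenstein lattice `Λ`, generated by `v₀, v₁, v₂`. -/
def eisensteinLattice : AddSubgroup ℂ := AddSubgroup.closure (range v)

/-- The lattice points visible from the origin. -/
def visible : Set ℂ :=
  {w | w ∈ eisensteinLattice ∧ ∀ c : ℝ, 0 < c → c < 1 → (c : ℂ) * w ∉ eisensteinLattice}

/-- The hexagonal norm: the minimum of `|a| + |b| + |c|` over all real `a, b, c` with
`w = a v₀ + b v₁ + c v₂`. -/
def hexNorm (w : ℂ) : ℝ :=
  sInf {r : ℝ | ∃ a b c : ℝ, w = a • v 0 + b • v 1 + c • v 2 ∧ r = |a| + |b| + |c|}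

/-- The set `𝒟`: directions of visible lattice points whose hexagonal norm is divisible by 3. -/
def driftDirections : Set Circle :=
  {θ | ∃ w ∈ visible, (∃ k : ℤ, hexNorm w = 3 * k) ∧ (θ : ℂ) = w / (‖w‖ : ℂ)}

/-- The set `𝒫`: directions of visible lattice points whose hexagonal norm is not divisible
by 3. -/
def periodicDirections : Set Circle :=
  {θ | ∃ w ∈ visible, (¬ ∃ k : ℤ, hexNorm w = 3 * k) ∧ (θ : ℂ) = w / (‖w‖ : ℂ)}

/-! ### The trihexagonal tiling -/

/-- The centers of the hexagons: the points of `2Λ`. -/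
def centers : Set ℂ := {c | ∃ l ∈ eisensteinLattice, c = 2 * l}

/-- The closed regular hexagon with center `c` and vertices `c ± vᵢ`. -/
def hexagon (c : ℂ) : Set ℂ :=
  convexHull ℝ (range (fun i => c + v i) ∪ range (fun i => c - v i))

/-- For `i ≠ j`, the points `c + vᵢ` and `c - vⱼ` are adjacent vertices of `hexagon c`; this is the
closed equilateral triangle on the other side of the edge joining them. -/
def triangle (c : ℂ) (i j : Fin 3) : Set ℂ :=
  convexHull ℝ {c + v i, c - v j, c + v i - v j}

/-- The tiles of the trihexagonal tiling. -/
def tiles : Set (Set ℂ) :=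
  {R | ∃ c ∈ centers, R = hexagon c ∨ ∃ i j, i ≠ j ∧ R = triangle c i j}

/-- The edge of `hexagon c` joining the adjacent vertices `c + vᵢ` and `c - vⱼ` (`i ≠ j`), without
its endpoints. Every edge of the tiling is an edge of exactly one hexagon. -/
def openEdge (c : ℂ) (i j : Fin 3) : Set ℂ := openSegment ℝ (c + v i) (c - v j)

/-- The line through the origin parallel to the edge joining `c + vᵢ` and `c - vⱼ`. -/
def edgeLine (i j : Fin 3) : Submodule ℝ ℂ := Submodule.span ℝ {v i + v j}

/-- Translation by `τ` is a symmetry of the tiling: it maps the set of tiles onto itself. -/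
def IsTranslationSymmetry (τ : ℂ) : Prop :=
  image (fun z : ℂ => z + τ) '' tiles = tiles

/-! ### The refractive flow on the unit tangent bundle `ℂ × Circle` -/

/-- `γ` moves along a straight line at unit speed in its current direction throughout a time
interval during which it is in the interior of a tile; here this is required near the time `t`. -/
def MovesThroughTile (γ : ℝ → ℂ × Circle) (t : ℝ) : Prop :=
  (∃ R ∈ tiles, (γ t).1 ∈ interior R) ∧
    ∀ᶠ r in 𝓝 t, γ r = ((γ t).1 + ((r - t : ℝ) : ℂ) * ((γ t).2 : ℂ), (γ t).2)

/-- At time `t`, `γ` crosses the interior of an edge transversally and is refracted there with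
refraction coefficient `-1`: it arrives on a straight line in direction `u`, and leaves on a
straight line in the direction opposite to the reflection of `u` across the edge (so that the
component along the edge changes sign and the component normal to the edge is kept). The unit
tangent vector at the crossing time itself is the outgoing one. -/
def IsRefractedAtEdge (γ : ℝ → ℂ × Circle) (t : ℝ) : Prop :=
  ∃ c ∈ centers, ∃ i j : Fin 3, i ≠ j ∧ (γ t).1 ∈ openEdge c i j ∧
    ((γ t).2 : ℂ) ∉ edgeLine i j ∧
    (∀ᶠ r in 𝓝[≥] t, γ r = ((γ t).1 + ((r - t : ℝ) : ℂ) * ((γ t).2 : ℂ), (γ t).2)) ∧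
    ∃ u : Circle, ((γ t).2 : ℂ) = -((edgeLine i j).reflection (u : ℂ)) ∧
      ∀ᶠ r in 𝓝[<] t, γ r = ((γ t).1 + ((r - t : ℝ) : ℂ) * (u : ℂ), u)

/-- `γ` is a trajectory of the refractive flow during the time interval `I`. In particular it does
not meet a vertex of the tiling (a singularity of the flow) during `I`. -/
structure IsTrajectoryOn (I : Set ℝ) (γ : ℝ → ℂ × Circle) : Prop where
  isOpen : IsOpen I
  ordConnected : I.OrdConnected
  step : ∀ t ∈ I, MovesThroughTile γ t ∨ IsRefractedAtEdge γ t

/-- A non-singular trajectory: one that is defined for all time. -/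
def IsNonsingularTrajectory (γ : ℝ → ℂ × Circle) : Prop := IsTrajectoryOn univ γ

/-- The invariant set `X_{θ,s}`: the unit tangent vectors whose trajectory travels in a direction
`θ`, `θ + 2π/3` or `θ + 4π/3` whenever it is within a hexagon, and travels around the center of
that hexagon counterclockwise (`s = 1`) or clockwise (`s = -1`). Directions are written
multiplicatively; rotation by `2πk/3` is multiplication by `v k`. -/
def X (θ : Circle) (s : ℤˣ) : Set (ℂ × Circle) :=
  {x | (∃ I γ, IsTrajectoryOn I γ ∧ (0 : ℝ) ∈ I ∧ γ 0 = x) ∧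
    ∀ I γ, IsTrajectoryOn I γ → (0 : ℝ) ∈ I → γ 0 = x →
      ∀ t ∈ I, ∀ c ∈ centers, (γ t).1 ∈ interior (hexagon c) →
        (∃ k : Fin 3, ((γ t).2 : ℂ) = v k * (θ : ℂ)) ∧
        0 < ((s : ℤ) : ℝ) * (((γ t).1 - c).re * ((γ t).2 : ℂ).im -
          ((γ t).1 - c).im * ((γ t).2 : ℂ).re)}

/-- A periodic trajectory. -/
def IsPeriodicTrajectory (γ : ℝ → ℂ × Circle) : Prop :=
  IsNonsingularTrajectory γ ∧ ∃ P : ℝ, 0 < P ∧ Function.Periodic γ P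

/-- A drift-periodic trajectory: one invariant under a non-trivial translational symmetry of the
tiling (acting on unit tangent vectors). -/
def IsDriftPeriodicTrajectory (γ : ℝ → ℂ × Circle) : Prop :=
  IsNonsingularTrajectory γ ∧ ∃ τ : ℂ, τ ≠ 0 ∧ IsTranslationSymmetry τ ∧
    (fun x : ℂ × Circle => (x.1 + τ, x.2)) '' range γ = range γ

/-- The flow `T_{θ,s}` is completely periodic: every non-singular trajectory in `X_{θ,s}` is
periodic. -/
def CompletelyPeriodic (θ : Circle) (s : ℤˣ) : Prop :=
  ∀ γ, IsNonsingularTrajectory γ → γ 0 ∈ X θ s → IsPeriodicTrajectory γ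

/-- The flow `T_{θ,s}` is completely drift-periodic: every non-singular trajectory in `X_{θ,s}` is
drift-periodic. -/
def CompletelyDriftPeriodic (θ : Circle) (s : ℤˣ) : Prop :=
  ∀ γ, IsNonsingularTrajectory γ → γ 0 ∈ X θ s → IsDriftPeriodicTrajectory γ

end Trihex

end

/-!
In the basis `1, exp (π i / 3)` of the plane, completed by a third coordinate that makes the sum
zero, the edges of the tiling lie on the lines where some coordinate is an odd integer, the hexagon
centers are the points with even integer coordinates, and crossing a wall with refraction
coefficient `-1` exchanges the two other coordinates of the direction. All symmetries of the tiling
that fix the origin are permutations of the coordinates, combined with signs.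

A trajectory that enters a triangle from one hexagon leaves it into another one, and its direction
is then rotated by a third of a turn (`IsFlowLine.cross_triangle`). The side of the hexagon center on
which it passes does not change, and a trajectory through a center runs into a vertex. By symmetry
the direction may be taken to be `(a, b, -a - b)` with `a > 0`, `b ≥ 0`, and the angular momentum
around the centers to be positive. In the rotated frame there are only two ways to leave a
hexagon, and the momentum `m`, which ranges over `(0, a + b)`, undergoes the rotation
`m ↦ m + a` modulo `a + b` (`IsFlowLine.hex_step`). The centers change by one of two vectors, which
are rotated by a third of a turn from each visit to the next.

If `(a, b)` is proportional to coprime integers `(x, y)`, then the hexagonal norm of the direction is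
`N = x + y`, and the momentum has period `N`. If `3 ∤ N`, then the displacements of the center
during three consecutive periods are the three rotated copies of one vector and cancel
(`IsItinerary.center_periodic`), so the trajectory is periodic. If `3 ∣ N`, then each period gives
the same displacement; modulo 3 an invariant of it is `y - x`, which is not divisible by 3, so that
the displacement is not zero (`IsItinerary.exists_drift`) and the trajectory is drift-periodic.
Conversely, a periodic or drift-periodic trajectory takes some momentum twice, after `i` steps
`+ a` and `j` steps `- b`, whence `i * a = j * b` and the direction is rational
(`IsItinerary.exists_rational`). Uniqueness of trajectories (`flow_unique`) carries these statements
about the visits to hexagons over to the flow.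
-/

noncomputable section

namespace Trihex

open scoped Fin.CommRing

/-! ### The flow in hexagonal coordinates -/

/-- The walls of the tiling are the lines on which some hexagonal coordinate is an odd integer. -/
def IsOddInt (x : ℝ) : Prop := ∃ n : ℤ, x = 2 * n + 1

/-- The refraction law at the point with coordinates `p`: `e` is the incoming and `d` the outgoing
direction. Off the walls the direction does not change. On a wall where coordinate `i` is odd, the
other two coordinates of the direction are exchanged; `j ↦ 2 * i - j` is the transposition of
`Fin 3` that fixes `i`. -/
def Refracts (p d e : Fin 3 → ℝ) : Prop :=
  ((∀ i, ¬ IsOddInt (p i)) ∧ e = d) ∨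
    ∃ i, IsOddInt (p i) ∧ (∀ j, j ≠ i → ¬ IsOddInt (p j)) ∧ d i ≠ 0 ∧ ∀ j, e j = d (2 * i - j)

/-- The position `q` and the direction `d` follow the refractive flow near the time `t`, in
hexagonal coordinates. -/
def FlowsAt (q d : ℝ → Fin 3 → ℝ) (t : ℝ) : Prop :=
  ∃ e : Fin 3 → ℝ, (∀ᶠ r in 𝓝[≥] t, q r = q t + (r - t) • d t ∧ d r = d t) ∧
    (∀ᶠ r in 𝓝[<] t, q r = q t + (r - t) • e ∧ d r = e) ∧ Refracts (q t) (d t) e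

/-- A trajectory of the refractive flow that is defined for all time, in hexagonal coordinates. -/
structure IsFlowLine (q d : ℝ → Fin 3 → ℝ) : Prop where
  sum_pos : ∀ t, q t 0 + q t 1 + q t 2 = 0
  sum_dir : ∀ t, d t 0 + d t 1 + d t 2 = 0
  dir_ne : ∀ t, d t ≠ 0
  flows : ∀ t, FlowsAt q d t

lemma Refracts.eq_iff {p d e d' e' : Fin 3 → ℝ} (h : Refracts p d e) (h' : Refracts p d' e') :
    d = d' ↔ e = e' := by
  rcases h with ⟨h1, rfl⟩ | ⟨i, hi, h2, -, h3⟩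
  · rcases h' with ⟨-, rfl⟩ | ⟨j, hj, -⟩
    · rfl
    · exact absurd hj (h1 j)
  · rcases h' with ⟨h4, -⟩ | ⟨j, hj, -, -, h5⟩
    · exact absurd hi (h4 i)
    · obtain rfl : j = i := by
        by_contra hne
        exact h2 j hne hj
      constructor
      · rintro rfl
        funext l
        rw [h3, h5]
      · rintro rfl
        funext l
        have := (h3 (2 * j - l)).symm.trans (h5 (2 * j - l))
        simpa using this

lemma FlowsAt.eventually_agree_iff {q d q' d' : ℝ → Fin 3 → ℝ} {t : ℝ} (h : FlowsAt q d t)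
    (h' : FlowsAt q' d' t) :
    ∀ᶠ r in 𝓝 t, ((q t = q' t ∧ d t = d' t) ↔ (q r = q' r ∧ d r = d' r)) := by
  obtain ⟨e, hr, hl, hw⟩ := h
  obtain ⟨e', hr', hl', hw'⟩ := h'
  rw [← nhdsLT_sup_nhdsGE, eventually_sup]
  constructor
  · filter_upwards [hl, hl'] with r ⟨h1, h2⟩ ⟨h3, h4⟩
    rw [h1, h2, h3, h4]
    constructor
    · rintro ⟨h5, h6⟩
      rw [← h5] at hw'
      rw [← (hw.eq_iff hw').1 h6, h5]
      exact ⟨rfl, rfl⟩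
    · rintro ⟨h5, rfl⟩
      have h5 : q t = q' t := by simpa using h5
      rw [← h5] at hw'
      exact ⟨h5, (hw.eq_iff hw').2 rfl⟩
  · filter_upwards [hr, hr'] with r ⟨h1, h2⟩ ⟨h3, h4⟩
    rw [h1, h2, h3, h4]
    constructor
    · rintro ⟨h5, h6⟩
      rw [h5, h6]
      exact ⟨rfl, rfl⟩
    · rintro ⟨h5, h6⟩
      rw [h6] at h5
      exact ⟨by simpa using h5, h6⟩

/-- Two trajectories that agree at one time agree throughout. -/
lemma flow_unique {q d q' d' : ℝ → Fin 3 → ℝ} {I : Set ℝ} (hI : I.OrdConnected)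
    (h : ∀ t ∈ I, FlowsAt q d t) (h' : ∀ t ∈ I, FlowsAt q' d' t) {a : ℝ} (ha : a ∈ I)
    (hq : q a = q' a) (hd : d a = d' a) {t : ℝ} (ht : t ∈ I) : q t = q' t ∧ d t = d' t := by
  refine (hI.isPreconnected.induction₂
    (fun x y => ((q x = q' x ∧ d x = d' x) ↔ (q y = q' y ∧ d y = d' y)))
    (fun x hx => ?_) (fun x y z _ _ _ h1 h2 => h1.trans h2) (fun x y _ _ h1 => h1.symm)
    ha ht).1 ⟨hq, hd⟩
  exact nhdsWithin_le_nhds ((h x hx).eventually_agree_iff (h' x hx))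

/-- A trajectory is straight as long as the line in its direction meets no wall. -/
lemma FlowsAt.straight {q d : ℝ → Fin 3 → ℝ} (h : ∀ t, FlowsAt q d t) {t T : ℝ} (hT : t < T)
    (hodd : ∀ s, t < s → s < T → ∀ i, ¬ IsOddInt (q t i + (s - t) * d t i)) :
    (∀ s, t ≤ s → s < T → q s = q t + (s - t) • d t ∧ d s = d t) ∧
      q T = q t + (T - t) • d t ∧ Refracts (q T) (d T) (d t) := by
  obtain ⟨-, hr, -, -⟩ := h t
  have hr1 : ∀ᶠ r in 𝓝[>] t, q r = q t + (r - t) • d t ∧ d r = d t :=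
    nhdsWithin_mono _ Ioi_subset_Ici_self hr
  obtain ⟨a, ⟨haq, had⟩, ha⟩ := (hr1.and (Ioo_mem_nhdsGT hT)).exists
  have hline : ∀ s ∈ Ioo t T, FlowsAt (fun s => q t + (s - t) • d t) (fun _ => d t) s := by
    intro s hs
    refine ⟨d t, Eventually.of_forall fun r => ⟨?_, rfl⟩, Eventually.of_forall fun r => ⟨?_, rfl⟩,
      Or.inl ⟨fun i => ?_, rfl⟩⟩
    · module
    · module
    · simpa using hodd s hs.1 hs.2 i
  have key : ∀ s ∈ Ioo t T, q s = q t + (s - t) • d t ∧ d s = d t := fun s hs =>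
    flow_unique ordConnected_Ioo (fun s _ => h s) hline ha haq had hs
  refine ⟨fun s hs hsT => ?_, ?_⟩
  · rcases hs.eq_or_lt with rfl | hs
    · simp
    · exact key s ⟨hs, hsT⟩
  · obtain ⟨e, -, hl, hw⟩ := h T
    obtain ⟨b, ⟨hbq, hbd⟩, hb⟩ := (hl.and (Ioo_mem_nhdsLT hT)).exists
    obtain ⟨h1, h2⟩ := key b hb
    obtain rfl : d t = e := h2.symm.trans hbd
    refine ⟨?_, hw⟩
    rw [h1] at hbq
    have : q T = q t + (b - t) • d t - (b - T) • d t := by rw [hbq]; module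
    rw [this]; module

lemma Refracts.comp_perm {p d e : Fin 3 → ℝ} (h : Refracts p d e) (σ : Equiv.Perm (Fin 3)) :
    Refracts (p ∘ σ) (d ∘ σ) (e ∘ σ) := by
  have hσ : ∀ (σ : Equiv.Perm (Fin 3)) (i j : Fin 3), σ (2 * i - j) = 2 * σ i - σ j := by decide
  rcases h with ⟨h1, rfl⟩ | ⟨i, hi, h2, h3, h4⟩
  · exact Or.inl ⟨fun i => h1 _, rfl⟩
  · refine Or.inr ⟨σ.symm i, by simpa using hi, fun j hj => h2 _ fun h => hj ?_, by simpa using h3,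
      fun j => ?_⟩
    · rw [← h]; simp
    · simp [hσ, h4]

lemma isOddInt_neg {x : ℝ} : IsOddInt (-x) ↔ IsOddInt x := by
  have key : ∀ x : ℝ, IsOddInt x → IsOddInt (-x) := by
    rintro x ⟨n, rfl⟩
    exact ⟨-n - 1, by push_cast; ring⟩
  exact ⟨fun h => by simpa using key _ h, key x⟩

lemma Refracts.neg {p d e : Fin 3 → ℝ} (h : Refracts p d e) : Refracts (-p) (-d) (-e) := by
  rcases h with ⟨h1, rfl⟩ | ⟨i, hi, h2, h3, h4⟩
  · exact Or.inl ⟨fun i => by simpa [isOddInt_neg] using h1 i, rfl⟩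
  · refine Or.inr ⟨i, by simpa [isOddInt_neg] using hi, fun j hj => ?_, by simpa using h3, fun j => ?_⟩
    · simpa [isOddInt_neg] using h2 j hj
    · simp [h4]

lemma IsFlowLine.comp_perm {q d : ℝ → Fin 3 → ℝ} (h : IsFlowLine q d) (σ : Equiv.Perm (Fin 3)) :
    IsFlowLine (fun t => q t ∘ σ) (fun t => d t ∘ σ) := by
  have hsum : ∀ (f : Fin 3 → ℝ), f 0 + f 1 + f 2 = 0 → f (σ 0) + f (σ 1) + f (σ 2) = 0 := by
    intro f hf
    have := Equiv.sum_comp σ f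
    rw [Fin.sum_univ_three, Fin.sum_univ_three] at this
    linarith
  refine ⟨fun t => hsum _ (h.sum_pos t), fun t => hsum _ (h.sum_dir t), fun t h0 => h.dir_ne t ?_,
    fun t => ?_⟩
  · funext i
    simpa using congrFun h0 (σ.symm i)
  · obtain ⟨e, hr, hl, hw⟩ := h.flows t
    refine ⟨e ∘ σ, ?_, ?_, hw.comp_perm σ⟩
    · filter_upwards [hr] with r ⟨h1, h2⟩
      rw [h1, h2]
      exact ⟨rfl, rfl⟩
    · filter_upwards [hl] with r ⟨h1, h2⟩
      rw [h1, h2]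
      exact ⟨rfl, rfl⟩

lemma IsFlowLine.neg {q d : ℝ → Fin 3 → ℝ} (h : IsFlowLine q d) :
    IsFlowLine (fun t => -q t) (fun t => -d t) := by
  refine ⟨fun t => ?_, fun t => ?_, fun t => neg_ne_zero.2 (h.dir_ne t), fun t => ?_⟩
  · have := h.sum_pos t
    simp only [Pi.neg_apply]; linarith
  · have := h.sum_dir t
    simp only [Pi.neg_apply]; linarith
  · obtain ⟨e, hr, hl, hw⟩ := h.flows t
    refine ⟨-e, ?_, ?_, hw.neg⟩
    · filter_upwards [hr] with r ⟨h1, h2⟩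
      rw [h1, h2]
      exact ⟨by module, rfl⟩
    · filter_upwards [hl] with r ⟨h1, h2⟩
      rw [h1, h2]
      exact ⟨by module, rfl⟩

/-- A trajectory cannot avoid the walls, since it would be a straight line then. -/
lemma IsFlowLine.exists_odd {q d : ℝ → Fin 3 → ℝ} (h : IsFlowLine q d) :
    ∃ t i, IsOddInt (q t i) := by
  by_contra! hno
  have hstr : ∀ x y : ℝ, q y = q x + (y - x) • d x ∧ d y = d x := by
    intro x y
    refine isPreconnected_univ.induction₂
      (fun x y => q y = q x + (y - x) • d x ∧ d y = d x) (fun x _ => ?_)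
      (fun x y z _ _ _ h1 h2 => ?_) (fun x y _ _ h1 => ?_) (mem_univ x) (mem_univ y)
    · rw [nhdsWithin_univ, ← nhdsLT_sup_nhdsGE, eventually_sup]
      obtain ⟨e, hr, hl, ⟨-, rfl⟩ | ⟨i, hi, -⟩⟩ := h.flows x
      · exact ⟨hl, hr⟩
      · exact absurd hi (hno x i)
    · rw [h2.1, h2.2, h1.1, h1.2]
      exact ⟨by module, rfl⟩
    · rw [h1.1, h1.2]
      exact ⟨by module, rfl⟩
  obtain ⟨i, hi⟩ : ∃ i, d 0 i ≠ 0 := by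
    by_contra! h0
    exact h.dir_ne 0 (funext h0)
  refine hno ((1 - q 0 i) / d 0 i) i ⟨0, ?_⟩
  rw [(hstr 0 _).1]
  simp [hi]

/-! ### Passages through triangles and hexagons -/

/-- The point with coordinates `p` is inside the hexagon whose center has coordinates `2 * k`. -/
def InHex (k : Fin 3 → ℤ) (p : Fin 3 → ℝ) : Prop :=
  k 0 + k 1 + k 2 = 0 ∧ ∀ i, |p i - 2 * k i| < 1

/-- The angular momentum, around the center `2 * k`, of a particle at `p` with velocity `d`, up to
the constant factor `√3 / 2`. -/
def momentum (k : Fin 3 → ℤ) (p d : Fin 3 → ℝ) : ℝ :=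
  (p 0 - 2 * k 0) * d 1 - (p 1 - 2 * k 1) * d 0

lemma eq_of_abs_sub_lt_one {x : ℝ} {a b : ℤ} (ha : |x - 2 * a| < 1) (hb : |x - 2 * b| < 1) :
    a = b := by
  rw [abs_lt] at ha hb
  have h1 : (2 * a : ℝ) < 2 * b + 2 := by linarith
  have h2 : (2 * b : ℝ) < 2 * a + 2 := by linarith
  have h1 : 2 * a < 2 * b + 2 := by exact_mod_cast h1
  have h2 : 2 * b < 2 * a + 2 := by exact_mod_cast h2
  omega

lemma not_isOddInt_of_abs_lt {x : ℝ} {a : ℤ} (ha : |x - 2 * a| < 1) : ¬ IsOddInt x := by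
  rintro ⟨n, rfl⟩
  rw [abs_lt] at ha
  have h1 : (2 * n : ℝ) < 2 * a := by linarith
  have h2 : (2 * a : ℝ) < 2 * n + 2 := by linarith
  have h1 : 2 * n < 2 * a := by exact_mod_cast h1
  have h2 : 2 * a < 2 * n + 2 := by exact_mod_cast h2
  omega

lemma InHex.unique {k l : Fin 3 → ℤ} {p : Fin 3 → ℝ} (hk : InHex k p) (hl : InHex l p) : k = l :=
  funext fun i => eq_of_abs_sub_lt_one (hk.2 i) (hl.2 i)

lemma InHex.not_odd {k : Fin 3 → ℤ} {p : Fin 3 → ℝ} (hk : InHex k p) (i : Fin 3) :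
    ¬ IsOddInt (p i) := not_isOddInt_of_abs_lt (hk.2 i)

lemma sum_comp_perm_eq_zero {M : Type*} [AddCommMonoid M] {f : Fin 3 → M}
    (hf : f 0 + f 1 + f 2 = 0) (σ : Equiv.Perm (Fin 3)) : f (σ 0) + f (σ 1) + f (σ 2) = 0 := by
  have := Equiv.sum_comp σ f
  rw [Fin.sum_univ_three, Fin.sum_univ_three] at this
  rw [this, hf]

lemma InHex.comp_perm {k : Fin 3 → ℤ} {p : Fin 3 → ℝ} (hk : InHex k p)
    (σ : Equiv.Perm (Fin 3)) : InHex (k ∘ σ) (p ∘ σ) :=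
  ⟨sum_comp_perm_eq_zero hk.1 σ, fun i => hk.2 (σ i)⟩

lemma InHex.neg {k : Fin 3 → ℤ} {p : Fin 3 → ℝ} (hk : InHex k p) : InHex (-k) (-p) := by
  refine ⟨?_, fun i => ?_⟩
  · have := hk.1
    simp only [Pi.neg_apply]; omega
  · rw [← abs_neg]
    convert hk.2 i using 2
    simp only [Pi.neg_apply]; push_cast; ring

/-- Near a crossing of a wall the trajectory is in a hexagon, before or after the crossing. -/
lemma IsFlowLine.exists_inHex_of_odd {q d : ℝ → Fin 3 → ℝ} (h : IsFlowLine q d) {t : ℝ}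
    (ht : IsOddInt (q t 0)) : ∃ s k, InHex k (q s) := by
  obtain ⟨e, hr, hl, ⟨h1, -⟩ | ⟨i, hi, h2, h3, h4⟩⟩ := h.flows t
  · exact absurd ht (h1 0)
  obtain rfl : i = 0 := by
    by_contra hne
    exact h2 0 (Ne.symm hne) ht
  obtain ⟨n, hn⟩ := ht
  have he : e 0 = d t 0 := by simpa using h4 0
  have hs := h.sum_pos t
  -- The trajectory approaches the crossing point on both sides of the wall.
  have hside : ∀ η : ℝ, η = 1 ∨ η = -1 → ∀ ε > 0, ∃ r, (∀ j, |q r j - q t j| < ε) ∧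
      0 < η * (q r 0 - q t 0) := by
    intro η hη ε hε
    have hsmall : ∀ f : Fin 3 → ℝ, ∀ᶠ r in 𝓝 t, ∀ j, |(r - t) * f j| < ε := by
      intro f
      rw [eventually_all]
      intro j
      have : ContinuousAt (fun r => |(r - t) * f j|) t := by fun_prop
      exact this.eventually_lt_const (by simpa using hε)
    have hη0 : η ≠ 0 := by rcases hη with rfl | rfl <;> norm_num
    rcases (mul_ne_zero hη0 h3).lt_or_gt with hneg | hpos
    · obtain ⟨r, ⟨⟨hq, -⟩, hsm⟩, hrt⟩ := ((hl.and (nhdsWithin_le_nhds (hsmall e))).and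
        self_mem_nhdsWithin).exists
      have hrt : r < t := hrt
      refine ⟨r, fun j => ?_, ?_⟩
      · rw [hq]; simpa using hsm j
      · rw [hq]
        simp only [Pi.add_apply, Pi.smul_apply, smul_eq_mul, he]
        nlinarith
    · have hr' : ∀ᶠ r in 𝓝[>] t, q r = q t + (r - t) • d t ∧ d r = d t :=
        nhdsWithin_mono _ Ioi_subset_Ici_self hr
      obtain ⟨r, ⟨⟨hq, -⟩, hsm⟩, hrt⟩ := ((hr'.and (nhdsWithin_le_nhds (hsmall (d t)))).and
        self_mem_nhdsWithin).exists
      have hrt : t < r := hrt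
      refine ⟨r, fun j => ?_, ?_⟩
      · rw [hq]; simpa using hsm j
      · rw [hq]
        simp only [Pi.add_apply, Pi.smul_apply, smul_eq_mul]
        nlinarith
  set m : ℤ := round (q t 1 / 2) with hm
  have hround := abs_sub_round (q t 1 / 2)
  rw [← hm, abs_le] at hround
  have hlo : 2 * (m : ℝ) - 1 < q t 1 := by
    refine lt_of_le_of_ne (by linarith [hround.1]) fun hc => h2 1 (by decide) ⟨m - 1, ?_⟩
    push_cast; linarith
  have hhi : q t 1 < 2 * (m : ℝ) + 1 := by
    refine lt_of_le_of_ne (by linarith [hround.2]) fun hc => h2 1 (by decide) ⟨m, ?_⟩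
    linarith
  have hne : q t 1 ≠ 2 * m := by
    intro hc
    refine h2 2 (by decide) ⟨-m - n - 1, ?_⟩
    push_cast; linarith
  rcases hne.lt_or_gt with hlt | hgt
  · obtain ⟨r, hr1, hr2⟩ := hside (-1) (Or.inr rfl)
      (min (min (q t 1 - (2 * m - 1)) (2 * m - q t 1)) 1) (by
        simp only [gt_iff_lt, lt_min_iff]; refine ⟨⟨?_, ?_⟩, ?_⟩ <;> linarith)
    simp only [lt_min_iff, abs_lt] at hr1
    obtain ⟨⟨⟨_, _⟩, _, _⟩, _, _⟩ := hr1 0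
    obtain ⟨⟨⟨_, _⟩, _, _⟩, _, _⟩ := hr1 1
    have := h.sum_pos r
    refine ⟨r, ![n, m, -m - n], by simp; ring, fun j => ?_⟩
    rw [abs_lt]
    fin_cases j <;> simp <;> constructor <;> linarith
  · obtain ⟨r, hr1, hr2⟩ := hside 1 (Or.inl rfl)
      (min (min (2 * m + 1 - q t 1) (q t 1 - 2 * m)) 1) (by
        simp only [gt_iff_lt, lt_min_iff]; refine ⟨⟨?_, ?_⟩, ?_⟩ <;> linarith)
    simp only [lt_min_iff, abs_lt] at hr1
    obtain ⟨⟨⟨_, _⟩, _, _⟩, _, _⟩ := hr1 0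
    obtain ⟨⟨⟨_, _⟩, _, _⟩, _, _⟩ := hr1 1
    have := h.sum_pos r
    refine ⟨r, ![n + 1, m, -m - n - 1], by simp; ring, fun j => ?_⟩
    rw [abs_lt]
    fin_cases j <;> simp <;> constructor <;> linarith

lemma IsFlowLine.exists_inHex {q d : ℝ → Fin 3 → ℝ} (h : IsFlowLine q d) :
    ∃ t k, InHex k (q t) := by
  obtain ⟨t, i, hi⟩ := h.exists_odd
  obtain ⟨s, k, hk⟩ := (h.comp_perm (Equiv.addRight i)).exists_inHex_of_odd (t := t)
    (by simpa using hi)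
  have := hk.comp_perm (Equiv.addRight i).symm
  rw [Function.comp_assoc, Equiv.self_comp_symm] at this
  exact ⟨s, _, this⟩

lemma Refracts.of_isOddInt {p d e : Fin 3 → ℝ} (h : Refracts p d e) {i : Fin 3}
    (hi : IsOddInt (p i)) : (∀ j, j ≠ i → ¬ IsOddInt (p j)) ∧ ∀ j, d j = e (2 * i - j) := by
  rcases h with ⟨h1, -⟩ | ⟨l, hl, h2, -, h4⟩
  · exact absurd hi (h1 i)
  · obtain rfl : l = i := by
      by_contra hne
      exact h2 i (Ne.symm hne) hi
    exact ⟨h2, fun j => by simp [h4]⟩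

/-- The passage through a triangle. A particle with positive momentum leaves the hexagon `k` through
the wall where the first coordinate is `2 * k 0 + 1`. It then leaves the triangle behind that wall
through the wall where the second coordinate is `2 * k 1 - 1`, into the hexagon
`k + (1, -1, 0)`, and the two refractions together rotate its direction. With zero momentum it would
run into the vertex of the triangle opposite to the first wall. -/
lemma IsFlowLine.cross_triangle {q d : ℝ → Fin 3 → ℝ} (h : IsFlowLine q d) {T m : ℝ}
    {D : Fin 3 → ℝ} {k : Fin 3 → ℤ} (hk : k 0 + k 1 + k 2 = 0) (hD : D 0 + D 1 + D 2 = 0)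
    (hD0 : 0 < D 0) (hw : Refracts (q T) (d T) D) (h0 : q T 0 = 2 * k 0 + 1)
    (h1 : |q T 1 - 2 * k 1| < 1) (h2 : |q T 2 - 2 * k 2| < 1)
    (hm : D 1 - (q T 1 - 2 * k 1) * D 0 = m) (hm0 : 0 ≤ m) :
    0 < m ∧ ∃ T' > T, InHex ![k 0 + 1, k 1 - 1, k 2] (q T') ∧
      ∀ s, T ≤ s → s ≤ T' → ∀ l, InHex l (q s) → l = ![k 0 + 1, k 1 - 1, k 2] ∧
        (∀ i, d s i = D (i + 1)) ∧ momentum l (q s) (d s) = m - D 1 := by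
  obtain ⟨-, hd⟩ := hw.of_isOddInt (i := 0) ⟨k 0, h0⟩
  have hd0 : d T 0 = D 0 := hd 0
  have hd1 : d T 1 = D 2 := hd 1
  have hd2 : d T 2 = D 1 := hd 2
  have hks : (k 0 + k 1 + k 2 : ℝ) = 0 := by exact_mod_cast hk
  have hsum := h.sum_pos T
  set a : ℝ := q T 1 - 2 * k 1 with ha
  have hb : q T 2 - 2 * k 2 = -1 - a := by linarith
  rw [hb] at h2
  rw [abs_lt] at h1 h2
  have hS : 0 < D 0 + D 1 := by nlinarith
  have hSne := hS.ne'
  set s₁ : ℝ := (1 + a) / (D 0 + D 1) with hs₁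
  have hs₁pos : 0 < s₁ := div_pos (by linarith) hS
  have hs₁S : s₁ * (D 0 + D 1) = 1 + a := by rw [hs₁]; field_simp
  have hx₁ : s₁ * D 0 = 1 - m / (D 0 + D 1) := by
    rw [hs₁, ← hm]; field_simp; ring
  have hmS : 0 ≤ m / (D 0 + D 1) := div_nonneg hm0 hS.le
  -- The position inside the triangle.
  have htri : ∀ s, T < s → s < T + s₁ → (0 < (s - T) * D 0 ∧ (s - T) * D 0 < 1) ∧
      (-1 < a + (s - T) * D 2 ∧ a + (s - T) * D 2 < 0) ∧
      (-1 < -1 - a + (s - T) * D 1 ∧ -1 - a + (s - T) * D 1 < 0) := by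
    intro s hs1 hs2
    have hu : 0 < s - T := by linarith
    have hu1 : 0 < s₁ - (s - T) := by linarith
    have hA : 0 < (s - T) * D 0 := mul_pos hu hD0
    have hA' : 0 < (s₁ - (s - T)) * D 0 := mul_pos hu1 hD0
    have hB : 0 < (s - T) * (D 0 + D 1) := mul_pos hu hS
    have hB' : 0 < (s₁ - (s - T)) * (D 0 + D 1) := mul_pos hu1 hS
    have hD2 : D 2 = -(D 0 + D 1) := by linarith
    rw [hD2]
    refine ⟨⟨hA, by linarith⟩, ⟨by linarith, by linarith⟩, ?_, by linarith⟩
    have hC : (-a) + s₁ * D 1 = m / (D 0 + D 1) := by linarith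
    rcases le_or_gt 0 (D 1) with hp | hp
    · have := mul_nonneg hu.le hp
      linarith
    · have := mul_pos_of_neg_of_neg (a := -(s₁ - (s - T))) (by linarith) hp
      linarith
  obtain ⟨hstr, hqT, hw'⟩ := FlowsAt.straight h.flows (t := T) (T := T + s₁) (by linarith) (by
    intro s hs1 hs2 i
    obtain ⟨hx, hy, hz⟩ := htri s hs1 hs2
    fin_cases i
    · refine not_isOddInt_of_abs_lt (a := k 0 + 1) (abs_lt.2 ?_)
      simp only [Fin.zero_eta, hd0, h0]; push_cast
      constructor <;> linarith
    · refine not_isOddInt_of_abs_lt (a := k 1) (abs_lt.2 ?_)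
      simp only [Fin.mk_one, hd1]
      constructor <;> linarith
    · refine not_isOddInt_of_abs_lt (a := k 2) (abs_lt.2 ?_)
      simp only [Fin.reduceFinMk, hd2]
      constructor <;> linarith)
  set T₁ := T + s₁ with hT₁
  have hpos0 : q T₁ 0 = 2 * k 0 + 1 + s₁ * D 0 := by
    rw [hqT]; simp [h0, hd0, hT₁]
  have hpos1 : q T₁ 1 = 2 * k 1 - 1 := by
    rw [hqT]; simp only [Pi.add_apply, Pi.smul_apply, smul_eq_mul, hd1, hT₁]
    have : D 2 = -(D 0 + D 1) := by linarith
    rw [this]; linarith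
  have hpos2 : q T₁ 2 = 2 * k 2 - s₁ * D 0 := by
    have := h.sum_pos T₁
    linarith
  obtain ⟨hno, hd'⟩ := hw'.of_isOddInt (i := 1) ⟨k 1 - 1, by rw [hpos1]; push_cast; ring⟩
  have hd'0 : d T₁ 0 = D 1 := by rw [hd' 0]; exact hd2
  have hd'1 : d T₁ 1 = D 2 := by rw [hd' 1]; exact hd1
  have hd'2 : d T₁ 2 = D 0 := by rw [hd' 2]; exact hd0
  have hmpos : 0 < m := by
    refine lt_of_le_of_ne hm0 fun hc => hno 2 (by decide) ⟨k 2 - 1, ?_⟩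
    rw [hpos2, hx₁, ← hc]; push_cast; ring
  have hmS' : 0 < m / (D 0 + D 1) := div_pos hmpos hS
  have hs₁D : 0 < s₁ * D 0 := mul_pos hs₁pos hD0
  refine ⟨hmpos, ?_⟩
  obtain ⟨-, hr, -, -⟩ := h.flows T₁
  have hnear : ∀ᶠ s in 𝓝 T₁, |(s - T₁) * D 1| < m / (D 0 + D 1) ∧ |(s - T₁) * D 1| < s₁ * D 0 ∧
      |(s - T₁) * D 2| < 1 ∧ |(s - T₁) * D 0| < m / (D 0 + D 1) ∧ |(s - T₁) * D 0| < s₁ * D 0 := by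
    have hsm : ∀ (c ε : ℝ), 0 < ε → ∀ᶠ s in 𝓝 T₁, |(s - T₁) * c| < ε := by
      intro c ε hε
      have : ContinuousAt (fun r => |(r - T₁) * c|) T₁ := by fun_prop
      exact this.eventually_lt_const (by simpa using hε)
    filter_upwards [hsm (D 1) _ hmS', hsm (D 1) _ hs₁D, hsm (D 2) 1 one_pos, hsm (D 0) _ hmS',
      hsm (D 0) _ hs₁D] with s a1 a2 a3 a4 a5
    exact ⟨a1, a2, a3, a4, a5⟩
  have hafter : ∀ᶠ s in 𝓝[>] T₁, InHex ![k 0 + 1, k 1 - 1, k 2] (q s) ∧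
      (∀ i, d s i = D (i + 1)) ∧
      momentum ![k 0 + 1, k 1 - 1, k 2] (q s) (d s) = m - D 1 := by
    filter_upwards [nhdsWithin_mono _ Ioi_subset_Ici_self hr, nhdsWithin_le_nhds hnear,
      self_mem_nhdsWithin] with s ⟨hs1, hs2⟩ ⟨a1, a2, a3, a4, a5⟩ hs
    have hs : T₁ < s := hs
    have hq0 : q s 0 = 2 * k 0 + 1 + s₁ * D 0 + (s - T₁) * D 1 := by
      rw [hs1]; simp [hpos0, hd'0]
    have hq1 : q s 1 = 2 * k 1 - 1 + (s - T₁) * D 2 := by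
      rw [hs1]; simp [hpos1, hd'1]
    have hq2 : q s 2 = 2 * k 2 - s₁ * D 0 + (s - T₁) * D 0 := by
      rw [hs1]; simp [hpos2, hd'2]
    have hneg : (s - T₁) * D 2 < 0 := mul_neg_of_pos_of_neg (by linarith) (by linarith)
    rw [abs_lt] at a1 a2 a3 a4 a5
    refine ⟨⟨?_, fun i => ?_⟩, fun i => ?_, ?_⟩
    · simp; omega
    · rw [abs_lt]
      fin_cases i
      · simp [hq0]; constructor <;> linarith
      · simp [hq1]; constructor <;> linarith
      · simp [hq2]; constructor <;> linarith
    · rw [hs2]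
      fin_cases i
      · exact hd'0
      · exact hd'1
      · exact hd'2
    · simp only [momentum, hs2, hq0, hq1, hd'0, hd'1]
      simp
      have hD2 : D 2 = -(D 0 + D 1) := by linarith
      rw [hD2, ← hm]
      linear_combination (-D 0) * hs₁S
  obtain ⟨u, hu, hsub⟩ := mem_nhdsGT_iff_exists_Ioc_subset.1 hafter
  have hu : T₁ < u := hu
  refine ⟨u, by linarith, (hsub ⟨hu, le_rfl⟩).1, fun s hs1 hs2 l hl => ?_⟩
  rcases lt_or_ge s T₁ with hlt | hge
  · exfalso
    rcases hs1.eq_or_lt with rfl | hs1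
    · exact hl.not_odd 0 ⟨k 0, h0⟩
    · obtain ⟨hx, hy, hz⟩ := htri s hs1 hlt
      obtain ⟨hq, -⟩ := hstr s hs1.le hlt
      have e0 : l 0 = k 0 + 1 := eq_of_abs_sub_lt_one (hl.2 0) (abs_lt.2 (by
        rw [hq]; simp only [Pi.add_apply, Pi.smul_apply, smul_eq_mul, h0, hd0]; push_cast
        constructor <;> linarith))
      have e1 : l 1 = k 1 := eq_of_abs_sub_lt_one (hl.2 1) (abs_lt.2 (by
        rw [hq]; simp only [Pi.add_apply, Pi.smul_apply, smul_eq_mul, hd1]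
        constructor <;> linarith))
      have e2 : l 2 = k 2 := eq_of_abs_sub_lt_one (hl.2 2) (abs_lt.2 (by
        rw [hq]; simp only [Pi.add_apply, Pi.smul_apply, smul_eq_mul, hd2]
        constructor <;> linarith))
      have := hl.1
      omega
  · rcases hge.eq_or_lt with rfl | hgt
    · exact absurd ⟨k 1 - 1, by rw [hpos1]; push_cast; ring⟩ (hl.not_odd 1)
    · obtain ⟨b1, b2, b3⟩ := hsub ⟨hgt, hs2⟩
      obtain rfl := hl.unique b1
      exact ⟨rfl, b2, b3⟩

lemma momentum_addRight_one {k : Fin 3 → ℤ} {p d : Fin 3 → ℝ} (hk : k 0 + k 1 + k 2 = 0)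
    (hp : p 0 + p 1 + p 2 = 0) (hd : d 0 + d 1 + d 2 = 0) :
    momentum (k ∘ Equiv.addRight 1) (p ∘ Equiv.addRight 1) (d ∘ Equiv.addRight 1) =
      momentum k p d := by
  have hk' : (k 0 + k 1 + k 2 : ℝ) = 0 := by exact_mod_cast hk
  have e1 : p 2 = -p 0 - p 1 := by linarith
  have e2 : d 2 = -d 0 - d 1 := by linarith
  have e3 : (k 2 : ℝ) = -k 0 - k 1 := by linarith
  simp only [momentum, Function.comp_apply, Equiv.coe_addRight, zero_add, Fin.reduceAdd]
  rw [e1, e2, e3]; ring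

/-- Angular momentum is invariant under the rotations of the coordinates. -/
lemma momentum_addRight {k : Fin 3 → ℤ} {p d : Fin 3 → ℝ} (hk : k 0 + k 1 + k 2 = 0)
    (hp : p 0 + p 1 + p 2 = 0) (hd : d 0 + d 1 + d 2 = 0) (j : Fin 3) :
    momentum (k ∘ Equiv.addRight j) (p ∘ Equiv.addRight j) (d ∘ Equiv.addRight j) =
      momentum k p d := by
  have h1 := momentum_addRight_one hk hp hd
  have h2 := momentum_addRight_one (k := k ∘ Equiv.addRight 1) (p := p ∘ Equiv.addRight 1)
    (d := d ∘ Equiv.addRight 1) (sum_comp_perm_eq_zero hk (Equiv.addRight 1))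
    (sum_comp_perm_eq_zero hp (Equiv.addRight 1)) (sum_comp_perm_eq_zero hd (Equiv.addRight 1))
  fin_cases j
  · have : (Equiv.addRight (0 : Fin 3)) = Equiv.refl _ := by decide
    simp [this]
  · exact h1
  · have : (Equiv.addRight (2 : Fin 3)) = (Equiv.addRight 1).trans (Equiv.addRight 1) := by decide
    simp only [Fin.reduceFinMk, this]
    rw [← h1, ← h2]
    rfl

lemma momentum_neg (k : Fin 3 → ℤ) (p d : Fin 3 → ℝ) :
    momentum (-k) (-p) (-d) = momentum k p d := by
  simp only [momentum, Pi.neg_apply]; push_cast; ring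

/-- The change of the halved center when a particle whose direction has signs `(+, +, -)` leaves
the hexagon through the wall where the last coordinate is smallest. -/
def lowStep : Fin 3 → ℤ := ![1, 0, -1]

/-- The change of the halved center when a particle whose direction has signs `(+, +, -)` leaves
the hexagon through the wall where the first coordinate is largest. -/
def highStep : Fin 3 → ℤ := ![1, -1, 0]

/-- The passage from one hexagon to the next one: the first return map to the hexagons is, in terms
of the momentum `m`, the rotation `m ↦ m + D 0` of the interval `(0, D 0 + D 1)` with its endpoints
identified. -/
lemma IsFlowLine.hex_step {q d : ℝ → Fin 3 → ℝ} (h : IsFlowLine q d) {t m : ℝ} {D : Fin 3 → ℝ}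
    {k : Fin 3 → ℤ} (ht : InHex k (q t)) (hd : d t = D) (hD0 : 0 < D 0) (hD1 : 0 ≤ D 1)
    (hm : momentum k (q t) D = m) (hm0 : 0 ≤ m) :
    0 < m ∧ m < D 0 + D 1 ∧ ∃ t' > t, ∃ k' m',
      ((m < D 1 ∧ m' = m + D 0 ∧ k' = k + lowStep) ∨
        (D 1 < m ∧ m' = m - D 1 ∧ k' = k + highStep)) ∧ InHex k' (q t') ∧
      ∀ s, t ≤ s → s ≤ t' → ∀ l, InHex l (q s) →
        (l = k ∧ d s = D ∧ momentum l (q s) (d s) = m) ∨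
        (l = k' ∧ (∀ i, d s i = D (i + 1)) ∧ momentum l (q s) (d s) = m') := by
  obtain ⟨hk, hx⟩ := ht
  have hks : (k 0 + k 1 + k 2 : ℝ) = 0 := by exact_mod_cast hk
  have hsum := h.sum_pos t
  have hD := h.sum_dir t
  rw [hd] at hD
  set x : ℝ := q t 0 - 2 * k 0 with hxd
  set y : ℝ := q t 1 - 2 * k 1 with hyd
  set z : ℝ := q t 2 - 2 * k 2 with hzd
  have hx0 := abs_lt.1 (hx 0)
  have hx1 := abs_lt.1 (hx 1)
  have hx2 := abs_lt.1 (hx 2)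
  rw [← hxd] at hx0
  rw [← hyd] at hx1
  rw [← hzd] at hx2
  have hxyz : x + y + z = 0 := by linarith
  have hmxy : x * D 1 - y * D 0 = m := hm
  have hS : 0 < D 0 + D 1 := by linarith
  have hq0 : q t 0 = 2 * k 0 + x := by rw [hxd]; ring
  have hq1 : q t 1 = 2 * k 1 + y := by rw [hyd]; ring
  have hq2 : q t 2 = 2 * k 2 + z := by rw [hzd]; ring
  have hD2 : D 2 = -(D 0 + D 1) := by linarith
  -- It suffices to find the time of exit and apply `cross_triangle` there.
  have main : ∀ u > 0, (∀ s, 0 < s → s < u → (-1 < x + s * D 0 ∧ x + s * D 0 < 1) ∧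
      (-1 < y + s * D 1 ∧ y + s * D 1 < 1) ∧ (-1 < z + s * D 2 ∧ z + s * D 2 < 1)) →
      (∀ s, t ≤ s → s < t + u → q s = q t + (s - t) • d t ∧ d s = d t) ∧
      q (t + u) = q t + (t + u - t) • d t ∧ Refracts (q (t + u)) (d (t + u)) (d t) ∧
      ∀ s, t ≤ s → s < t + u → ∀ l, InHex l (q s) →
        l = k ∧ d s = D ∧ momentum l (q s) (d s) = m := by
    intro u hu hin
    obtain ⟨h1, h2, h3⟩ := FlowsAt.straight h.flows (t := t) (T := t + u) (by linarith) (by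
      intro s hs1 hs2 i
      obtain ⟨a0, a1, a2⟩ := hin (s - t) (by linarith) (by linarith)
      refine not_isOddInt_of_abs_lt (a := k i) (abs_lt.2 ?_)
      rw [hd]
      fin_cases i
      · simp only [Fin.zero_eta, hq0]; constructor <;> linarith
      · simp only [Fin.mk_one, hq1]; constructor <;> linarith
      · simp only [Fin.reduceFinMk, hq2]; constructor <;> linarith)
    refine ⟨h1, h2, h3, fun s hs1 hs2 l hl => ?_⟩
    obtain ⟨g1, g2⟩ := h1 s hs1 hs2
    have hk' : InHex k (q s) := by
      refine ⟨hk, fun i => abs_lt.2 ?_⟩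
      rw [g1, hd]
      rcases hs1.eq_or_lt with rfl | hs1
      · simpa using abs_lt.1 (hx i)
      obtain ⟨a0, a1, a2⟩ := hin (s - t) (by linarith) (by linarith)
      simp only [Pi.add_apply, Pi.smul_apply, smul_eq_mul]
      fin_cases i
      · simp only [Fin.zero_eta, hq0]; constructor <;> linarith
      · simp only [Fin.mk_one, hq1]; constructor <;> linarith
      · simp only [Fin.reduceFinMk, hq2]; constructor <;> linarith
    obtain rfl := hl.unique hk'
    refine ⟨rfl, g2.trans hd, ?_⟩
    rw [g1, g2, hd]
    simp only [momentum, Pi.add_apply, Pi.smul_apply, smul_eq_mul, hq0, hq1]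
    linear_combination hmxy
  rcases lt_or_ge m (D 1) with hlt | hge
  · -- The exit is through the wall where the last coordinate is smallest.
    have hD1' : 0 < D 1 := lt_of_le_of_lt hm0 hlt
    set u : ℝ := (1 + z) / (D 0 + D 1) with hu
    have hu0 : 0 < u := div_pos (by linarith) hS
    have huS : u * (D 0 + D 1) = 1 + z := by rw [hu]; field_simp
    have hxu : x + u * D 0 = (m + D 0) / (D 0 + D 1) := by
      rw [hu, ← hmxy]; field_simp
      have : z = -x - y := by linarith
      rw [this]; ring
    have hX0 : 0 < x + u * D 0 := by rw [hxu]; positivity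
    have hX1 : x + u * D 0 < 1 := by rw [hxu, div_lt_one hS]; linarith
    obtain ⟨-, hqT, hwT, hcov⟩ := main u hu0 (by
      intro s hs0 hsu
      have a1 : 0 < s * D 0 := mul_pos hs0 hD0
      have a2 : 0 < s * D 1 := mul_pos hs0 hD1'
      have a3 : 0 < (u - s) * D 0 := mul_pos (by linarith) hD0
      have a4 : 0 < (u - s) * D 1 := mul_pos (by linarith) hD1'
      rw [hD2]
      refine ⟨⟨?_, ?_⟩, ⟨?_, ?_⟩, ?_, ?_⟩ <;> linarith)
    have hqT0 : q (t + u) 0 = 2 * k 0 + x + u * D 0 := by rw [hqT, hd]; simp [hq0]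
    have hqT1 : q (t + u) 1 = 2 * k 1 + y + u * D 1 := by rw [hqT, hd]; simp [hq1]
    have hqT2 : q (t + u) 2 = 2 * k 2 - 1 := by
      rw [hqT, hd]; simp [hq2, hD2]; linarith
    set σ : Equiv.Perm (Fin 3) := Equiv.addRight 2
    have hσ0 : σ 0 = 2 := rfl
    have hσ1 : σ 1 = 0 := rfl
    have hσ2 : σ 2 = 1 := rfl
    obtain ⟨hmpos, T', hT', hin', hcov'⟩ := ((h.comp_perm σ).neg).cross_triangle
      (T := t + u) (m := m) (D := -(D ∘ σ)) (k := -(k ∘ σ))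
      (by simp only [Pi.neg_apply, Function.comp_apply, hσ0, hσ1, hσ2]; omega)
      (by simp only [Pi.neg_apply, Function.comp_apply, hσ0, hσ1, hσ2]; linarith)
      (by simp only [Pi.neg_apply, Function.comp_apply, hσ0]; linarith)
      (by rw [hd] at hwT; exact (hwT.comp_perm σ).neg)
      (by simp only [Pi.neg_apply, Function.comp_apply, hσ0, hqT2]; push_cast; ring)
      (by
        simp only [Pi.neg_apply, Function.comp_apply, hσ1, hqT0]; push_cast
        rw [abs_lt]; constructor <;> linarith)
      (by
        simp only [Pi.neg_apply, Function.comp_apply, hσ2, hqT1]; push_cast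
        rw [abs_lt]; constructor <;> linarith)
      (by
        simp only [Pi.neg_apply, Function.comp_apply, hσ0, hσ1, hqT0]; push_cast
        rw [hD2, ← hmxy]
        have e : z = -x - y := by linarith
        rw [e] at huS
        linear_combination D 0 * huS)
      hm0
    have hback : ∀ l, l = k + lowStep ↔
        (-(l ∘ σ)) = ![(-(k ∘ σ)) 0 + 1, (-(k ∘ σ)) 1 - 1, (-(k ∘ σ)) 2] := by
      intro l
      simp only [funext_iff, Fin.forall_fin_succ, IsEmpty.forall_iff, lowStep]
      simp [hσ0, hσ1, hσ2]
      omega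
    refine ⟨hmpos, by linarith, T', by linarith, k + lowStep, m + D 0, Or.inl ⟨hlt, rfl, rfl⟩, ?_,
      fun s hs1 hs2 l hl => ?_⟩
    · have := (hin'.neg).comp_perm σ.symm
      have hσ' : σ.symm 0 = 1 ∧ σ.symm 1 = 2 ∧ σ.symm 2 = 0 := ⟨rfl, rfl, rfl⟩
      convert this using 1
      · funext i
        fin_cases i <;> simp [hσ', hσ0, hσ1, hσ2, lowStep]
        all_goals omega
      · funext i
        simp
    · rcases lt_or_ge s (t + u) with hsu | hsu
      · exact Or.inl (hcov s hs1 hsu l hl)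
      · right
        obtain ⟨b1, b2, b3⟩ := hcov' s hsu hs2 _ (hl.comp_perm σ).neg
        refine ⟨(hback l).2 b1, fun i => ?_, ?_⟩
        · have := b2 (i + 1)
          have e : ∀ i : Fin 3, i + 1 + 2 = i ∧ i + 1 + 1 + 2 = i + 1 := by decide
          simpa [σ, (e i).1, (e i).2] using this
        · rw [momentum_neg, momentum_addRight hl.1 (h.sum_pos s) (h.sum_dir s)] at b3
          rw [b3]
          simp [hσ1]
  · -- The exit is through the wall where the first coordinate is largest.
    set u : ℝ := (1 - x) / D 0 with hu
    have hu0 : 0 < u := div_pos (by linarith) hD0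
    have huD : u * D 0 = 1 - x := by rw [hu]; field_simp
    have hyu : y + u * D 1 = (D 1 - m) / D 0 := by
      rw [hu, ← hmxy]; field_simp; ring
    have hY0 : y + u * D 1 ≤ 0 := by
      rw [hyu]; exact div_nonpos_of_nonpos_of_nonneg (by linarith) hD0.le
    have huD1 : 0 ≤ u * D 1 := mul_nonneg hu0.le hD1
    obtain ⟨-, hqT, hwT, hcov⟩ := main u hu0 (by
      intro s hs0 hsu
      have a1 : 0 < s * D 0 := mul_pos hs0 hD0
      have a2 : 0 ≤ s * D 1 := mul_nonneg hs0.le hD1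
      have a3 : 0 < (u - s) * D 0 := mul_pos (by linarith) hD0
      have a4 : 0 ≤ (u - s) * D 1 := mul_nonneg (by linarith) hD1
      rw [hD2]
      refine ⟨⟨?_, ?_⟩, ⟨?_, ?_⟩, ?_, ?_⟩ <;> linarith)
    have hqT0 : q (t + u) 0 = 2 * k 0 + 1 := by
      rw [hqT, hd]; simp [hq0]; linarith
    have hqT1 : q (t + u) 1 = 2 * k 1 + y + u * D 1 := by rw [hqT, hd]; simp [hq1]
    have hqT2 : q (t + u) 2 = 2 * k 2 - 1 - (y + u * D 1) := by
      have := h.sum_pos (t + u)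
      linarith
    obtain ⟨hno, -⟩ := hwT.of_isOddInt (i := 0) ⟨k 0, hqT0⟩
    have hgt : D 1 < m := by
      refine lt_of_le_of_ne hge fun hc => hno 2 (by decide) ⟨k 2 - 1, ?_⟩
      rw [hqT2, hyu, hc]; push_cast; ring
    have hY : y + u * D 1 < 0 := by
      rw [hyu]; exact div_neg_of_neg_of_pos (by linarith) hD0
    obtain ⟨hmpos, T', hT', hin', hcov'⟩ := h.cross_triangle (T := t + u) (m := m) (D := D) (k := k)
      hk hD hD0 (by rw [← hd]; exact hwT) hqT0
      (by rw [hqT1, abs_lt]; constructor <;> linarith)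
      (by rw [hqT2, abs_lt]; constructor <;> linarith)
      (by rw [hqT1, ← hmxy]; linear_combination (-D 1) * huD) hm0
    have hk' : ![k 0 + 1, k 1 - 1, k 2] = k + highStep := by
      funext i
      fin_cases i <;> simp [highStep]
      all_goals (try omega)
    rw [hk'] at hin' hcov'
    refine ⟨hmpos, ?_, T', by linarith, k + highStep, m - D 1, Or.inr ⟨hgt, rfl, rfl⟩, hin',
      fun s hs1 hs2 l hl => ?_⟩
    · rw [← hmxy]
      nlinarith
    · rcases lt_or_ge s (t + u) with hsu | hsu
      · exact Or.inl (hcov s hs1 hsu l hl)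
      · exact Or.inr (hcov' s hsu hs2 l hl)

/-! ### Itineraries -/

/-- The sequence of momenta `m n` and of halved centers `k n` of the hexagons that a trajectory
visits. In the `n`-th hexagon its direction is `i ↦ D (i + (n : Fin 3))`, where `a = D 0` and `b = D 1`. -/
structure IsItinerary (a b : ℝ) (m : ℕ → ℝ) (k : ℕ → Fin 3 → ℤ) : Prop where
  pos : ∀ n, 0 < m n
  lt : ∀ n, m n < a + b
  step : ∀ n, (m n < b ∧ m (n + 1) = m n + a ∧ ∀ i, k (n + 1) i = k n i + lowStep (i + (n : Fin 3))) ∨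
    (b < m n ∧ m (n + 1) = m n - b ∧ ∀ i, k (n + 1) i = k n i + highStep (i + (n : Fin 3)))

/-- An invariant of steps modulo 3. If `k` has sum zero and `ω` is a primitive cube root of unity,
then `∑ i, k i * ω ^ i` is congruent to `level k * (ω - 1)` modulo `(1 - ω) ^ 2`. A rotation of `k`
multiplies the sum by a power of `ω`, hence preserves the level modulo 3, while low steps and high
steps have opposite levels. -/
def level (k : Fin 3 → ℤ) : ℤ := k 1 + 2 * k 2

lemma three_dvd_level_lowStep (j : Fin 3) : (3 : ℤ) ∣ level (fun i => lowStep (i + j)) - 1 := by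
  revert j; decide

lemma three_dvd_level_highStep (j : Fin 3) : (3 : ℤ) ∣ level (fun i => highStep (i + j)) + 1 := by
  revert j; decide

lemma IsItinerary.exists_count {a b : ℝ} {m : ℕ → ℝ} {k : ℕ → Fin 3 → ℤ}
    (h : IsItinerary a b m k) (n p : ℕ) : ∃ u v : ℕ, u + v = p ∧ m (n + p) = m n + u * a - v * b ∧
      (3 : ℤ) ∣ level (k (n + p)) - level (k n) - (u - v) := by
  induction p with
  | zero => exact ⟨0, 0, rfl, by simp, by simp⟩
  | succ p ih =>
    obtain ⟨u, v, huv, hm, hl⟩ := ih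
    rcases h.step (n + p) with ⟨-, h1, h2⟩ | ⟨-, h1, h2⟩
    · refine ⟨u + 1, v, by omega, ?_, ?_⟩
      · rw [← add_assoc, h1, hm]; push_cast; ring
      · have := three_dvd_level_lowStep ((n + p : ℕ) : Fin 3)
        simp only [level, ← add_assoc, h2] at *
        push_cast at this hl ⊢
        omega
    · refine ⟨u, v + 1, by omega, ?_, ?_⟩
      · rw [← add_assoc, h1, hm]; push_cast; ring
      · have := three_dvd_level_highStep ((n + p : ℕ) : Fin 3)
        simp only [level, ← add_assoc, h2] at *
        push_cast at this hl ⊢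
        omega

section Rational

variable {r : ℝ} {x y : ℕ} {m : ℕ → ℝ} {k : ℕ → Fin 3 → ℤ}

/-- For a rational direction the momentum is periodic. -/
lemma IsItinerary.period (hr : 0 < r) (h : IsItinerary (r * x) (r * y) m k) (n : ℕ) :
    m (n + (x + y)) = m n ∧
      (3 : ℤ) ∣ level (k (n + (x + y))) - level (k n) - (y - x) := by
  obtain ⟨u, v, huv, hm, hl⟩ := h.exists_count n (x + y)
  have hN : 0 < (x + y : ℝ) := by
    have := (h.pos 0).trans (h.lt 0)
    by_contra hc
    nlinarith
  have huv' : (u + v : ℝ) = x + y := by exact_mod_cast huv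
  have hdiff : m (n + (x + y)) - m n = r * ((x + y) * ((u : ℝ) - y)) := by
    rw [hm]
    have : (v : ℝ) = x + y - u := by linarith
    rw [this]; ring
  have h1 := h.pos n
  have h2 := h.lt n
  have h3 := h.pos (n + (x + y))
  have h4 := h.lt (n + (x + y))
  -- The total change is a multiple of the length of the interval in which the momenta lie.
  have hrN : 0 < r * (x + y) := mul_pos hr hN
  have h5 : (u : ℝ) - y < 1 := by
    by_contra hc
    nlinarith
  have h6 : -1 < (u : ℝ) - y := by
    by_contra hc
    nlinarith
  have h5 : (u : ℝ) < y + 1 := by linarith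
  have h6 : (y : ℝ) < u + 1 := by linarith
  have h5 : u < y + 1 := by exact_mod_cast h5
  have h6 : y < u + 1 := by exact_mod_cast h6
  obtain rfl : u = y := by omega
  obtain rfl : v = x := by omega
  exact ⟨by linear_combination hdiff, hl⟩

lemma IsItinerary.period_mul (hr : 0 < r) (h : IsItinerary (r * x) (r * y) m k) (n l : ℕ) :
    m (n + l * (x + y)) = m n := by
  induction l with
  | zero => simp
  | succ l ih => rw [← ih, add_mul, one_mul, ← add_assoc, (h.period hr _).1]

/-- The steps are periodic, up to the rotation of the direction. -/
lemma IsItinerary.exists_step (hr : 0 < r) (h : IsItinerary (r * x) (r * y) m k) (n : ℕ) :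
    ∃ f : Fin 3 → ℤ, f 0 + f 1 + f 2 = 0 ∧ ∀ l : ℕ, ∀ i,
      k (n + l * (x + y) + 1) i = k (n + l * (x + y)) i + f (i + ((n + l * (x + y) : ℕ) : Fin 3)) := by
  rcases h.step n with ⟨h1, -⟩ | ⟨h1, -⟩
  · refine ⟨lowStep, by decide, fun l i => ?_⟩
    rcases h.step (n + l * (x + y)) with ⟨-, -, h2⟩ | ⟨h2, -⟩
    · exact h2 i
    · rw [h.period_mul hr] at h2
      exact absurd h1 h2.not_gt
  · refine ⟨highStep, by decide, fun l i => ?_⟩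
    rcases h.step (n + l * (x + y)) with ⟨h2, -⟩ | ⟨-, -, h2⟩
    · rw [h.period_mul hr] at h2
      exact absurd h1 h2.not_gt
    · exact h2 i

lemma natCast_eq_zero_iff_three_dvd (n : ℕ) : (n : Fin 3) = 0 ↔ 3 ∣ n := by
  rw [Fin.natCast_eq_zero]

/-- If a period of the momentum rotates the direction, then the displacements during three
consecutive periods are the three rotated copies of one vector, so they add up to zero. -/
lemma IsItinerary.center_periodic (hr : 0 < r) (h : IsItinerary (r * x) (r * y) m k)
    (h3 : ¬ 3 ∣ x + y) (n : ℕ) : k (n + 3 * (x + y)) = k n := by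
  set N := x + y with hN
  have hconst : ∀ n i, k (n + 1) i + k (n + N + 1) i + k (n + 2 * N + 1) i =
      k n i + k (n + N) i + k (n + 2 * N) i := by
    intro n i
    obtain ⟨f, hf, hstep⟩ := h.exists_step hr n
    have s0 := hstep 0 i
    have s1 := hstep 1 i
    have s2 := hstep 2 i
    rw [← hN] at s0 s1 s2
    simp only [zero_mul, one_mul, add_zero] at s0 s1 s2
    rw [s0, s1, s2]
    have key : ∀ c ν : Fin 3, ν ≠ 0 → f c + f (c + ν) + f (c + 2 * ν) = 0 := by
      intro c ν hν
      fin_cases c <;> fin_cases ν <;> simp at hν ⊢ <;> omega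
    have := key (i + (n : Fin 3)) (N : Fin 3) (by rwa [Ne, natCast_eq_zero_iff_three_dvd])
    have e1 : i + ((n + N : ℕ) : Fin 3) = i + (n : Fin 3) + (N : Fin 3) := by push_cast; ring
    have e2 : i + ((n + 2 * N : ℕ) : Fin 3) = i + (n : Fin 3) + 2 * (N : Fin 3) := by
      push_cast; ring
    rw [e1, e2]
    linarith
  have hconst' : ∀ p i, k (n + p) i + k (n + p + N) i + k (n + p + 2 * N) i =
      k n i + k (n + N) i + k (n + 2 * N) i := by
    intro p i
    induction p with
    | zero => rfl
    | succ p ih =>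
      rw [← ih, ← hconst (n + p), show n + (p + 1) = n + p + 1 by ring, show n + p + 1 + N = n + p + N + 1 by ring,
        show n + p + 1 + 2 * N = n + p + 2 * N + 1 by ring]
  funext i
  have := hconst' N i
  have e1 : n + N + N = n + 2 * N := by ring
  have e2 : n + N + 2 * N = n + 3 * N := by ring
  rw [e1, e2] at this
  linarith

/-- If a period of the momentum does not rotate the direction, then the displacement during a period
is always the same vector; its level shows that it is not zero. -/
lemma IsItinerary.exists_drift (hr : 0 < r) (hxy : x.Coprime y)
    (h : IsItinerary (r * x) (r * y) m k) (h3 : 3 ∣ x + y) :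
    ∃ κ : Fin 3 → ℤ, κ ≠ 0 ∧ ∀ n l : ℕ, k (n + l * (x + y)) = k n + l • κ := by
  set N := x + y with hN
  have hconst : ∀ n, k (n + N) = k n + (k N - k 0) := by
    intro n
    induction n with
    | zero => simp
    | succ n ih =>
      obtain ⟨f, hf, hstep⟩ := h.exists_step hr n
      funext i
      have s0 := hstep 0 i
      have s1 := hstep 1 i
      rw [← hN] at s0 s1
      have hc : ((N : ℕ) : Fin 3) = 0 := (natCast_eq_zero_iff_three_dvd N).2 h3
      simp only [zero_mul, one_mul, add_zero, Nat.cast_add, hc] at s0 s1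
      have := congrFun ih i
      have e : n + 1 + N = n + N + 1 := by ring
      simp only [Pi.add_apply] at *
      rw [e, s1, s0, this]; ring
  refine ⟨k N - k 0, fun h0 => ?_, fun n l => ?_⟩
  · have hl := (h.period hr 0).2
    rw [← hN, zero_add, sub_eq_zero.1 h0, sub_self, zero_sub, dvd_neg] at hl
    have h1 : 3 ∣ x := by omega
    have h2 : 3 ∣ y := by omega
    have := Nat.dvd_gcd h1 h2
    rw [hxy] at this
    omega
  · induction l with
    | zero => simp
    | succ l ih =>
      rw [add_mul, one_mul, ← add_assoc, hconst, ih]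
      module

end Rational

/-- The direction of a trajectory is rational if the momentum takes a value twice. -/
lemma IsItinerary.exists_rational {a b : ℝ} {m : ℕ → ℝ} {k : ℕ → Fin 3 → ℤ}
    (h : IsItinerary a b m k) (ha : 0 < a) (hb : 0 ≤ b) {p : ℕ} (hp : 0 < p) (hm : m p = m 0) :
    ∃ r : ℝ, 0 < r ∧ ∃ x y : ℕ, x.Coprime y ∧ a = r * x ∧ b = r * y ∧ (x + y) ∣ p := by
  obtain ⟨u, v, huv, hm', -⟩ := h.exists_count 0 p
  rw [zero_add, hm] at hm'
  have hg : 0 < v.gcd u := Nat.gcd_pos_iff.2 (by omega)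
  obtain ⟨x, hx⟩ := Nat.gcd_dvd_left v u
  obtain ⟨y, hy⟩ := Nat.gcd_dvd_right v u
  set g := v.gcd u
  have hcop : x.Coprime y := by
    have := Nat.coprime_div_gcd_div_gcd hg
    rwa [Nat.div_eq_of_eq_mul_right hg hx, Nat.div_eq_of_eq_mul_right hg hy] at this
  have hpg : p = g * (x + y) := by rw [← huv, hx, hy]; ring
  have hN : 0 < x + y := Nat.pos_of_ne_zero fun h0 => by
    rw [h0, mul_zero] at hpg; omega
  have hN' : (0 : ℝ) < x + y := by exact_mod_cast hN
  have hg' : (g : ℝ) ≠ 0 := by exact_mod_cast hg.ne'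
  have hxv : (v : ℝ) = g * x := by exact_mod_cast hx
  have hyu : (u : ℝ) = g * y := by exact_mod_cast hy
  have hrel : (y : ℝ) * a = x * b := by
    apply mul_left_cancel₀ hg'
    rw [hxv, hyu] at hm'
    linarith
  refine ⟨(a + b) / (x + y), by positivity, x, y, hcop, ?_, ?_, ⟨g, by rw [hpg]; ring⟩⟩
  · field_simp; linarith
  · field_simp; linarith

/-- The visits of a trajectory to the hexagons: it is in the hexagon `k n` at the time `t n`, and
whenever it is in a hexagon after the time `t 0`, this is during one of these visits. -/
structure IsVisitSeq (q d : ℝ → Fin 3 → ℝ) (D : Fin 3 → ℝ) (t m : ℕ → ℝ) (k : ℕ → Fin 3 → ℤ) :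
    Prop where
  itinerary : IsItinerary (D 0) (D 1) m k
  strictMono : StrictMono t
  inHex : ∀ n, InHex (k n) (q (t n))
  dir : ∀ n i, d (t n) i = D (i + (n : Fin 3))
  momentum_eq : ∀ n, momentum (k n) (q (t n)) (d (t n)) = m n
  cover : ∀ s, t 0 ≤ s → ∀ l, InHex l (q s) →
    ∃ n, l = k n ∧ (∀ i, d s i = D (i + (n : Fin 3))) ∧
      momentum l (q s) (d s) = m n ∧ ∀ j, t (j + 1) ≤ s → j ≤ n

lemma IsFlowLine.hex_step_rotated {q d : ℝ → Fin 3 → ℝ} (h : IsFlowLine q d) {t m : ℝ}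
    {D : Fin 3 → ℝ} {k : Fin 3 → ℤ} (j : Fin 3) (ht : InHex k (q t)) (hd : ∀ i, d t i = D (i + j))
    (hD0 : 0 < D 0) (hD1 : 0 ≤ D 1) (hm : momentum k (q t) (d t) = m) (hm0 : 0 ≤ m) :
    0 < m ∧ m < D 0 + D 1 ∧ ∃ t' > t, ∃ k' m',
      ((m < D 1 ∧ m' = m + D 0 ∧ ∀ i, k' i = k i + lowStep (i + j)) ∨
        (D 1 < m ∧ m' = m - D 1 ∧ ∀ i, k' i = k i + highStep (i + j))) ∧ InHex k' (q t') ∧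
      ∀ s, t ≤ s → s ≤ t' → ∀ l, InHex l (q s) →
        (l = k ∧ (∀ i, d s i = D (i + j)) ∧ momentum l (q s) (d s) = m) ∨
        (l = k' ∧ (∀ i, d s i = D (i + (j + 1))) ∧ momentum l (q s) (d s) = m') := by
  have hmom : ∀ s l, InHex l (q s) → momentum (l ∘ Equiv.addRight (-j)) (q s ∘ Equiv.addRight (-j))
      (d s ∘ Equiv.addRight (-j)) = momentum l (q s) (d s) := fun s l hl =>
    momentum_addRight hl.1 (h.sum_pos s) (h.sum_dir s) (-j)
  have hd' : d t ∘ Equiv.addRight (-j) = D := by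
    funext i
    simp [hd]
  obtain ⟨h1, h2, t', ht', k', m', h3, h4, h5⟩ := (h.comp_perm (Equiv.addRight (-j))).hex_step
    (ht.comp_perm _) hd' hD0 hD1 ((by rw [← hd', hmom t k ht, hm])) hm0
  have hinv : ∀ {α : Type} (f : Fin 3 → α) (l : Fin 3 → α),
      l ∘ Equiv.addRight (-j) = f ↔ ∀ i, l i = f (i + j) := by
    intro α f l
    rw [funext_iff]
    constructor
    · intro hf i
      simpa using hf (i + j)
    · intro hf i
      simp [hf]
  refine ⟨h1, h2, t', ht', fun i => k' (i + j), m', ?_, ?_, ?_⟩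
  · rcases h3 with ⟨a1, a2, a3⟩ | ⟨a1, a2, a3⟩
    · exact Or.inl ⟨a1, a2, fun i => by simp [a3]⟩
    · exact Or.inr ⟨a1, a2, fun i => by simp [a3]⟩
  · have := h4.comp_perm (Equiv.addRight j)
    convert this using 1
    all_goals
      funext i
      simp
  · intro s hs1 hs2 l hl
    rcases h5 s hs1 hs2 _ (hl.comp_perm _) with ⟨a1, a2, a3⟩ | ⟨a1, a2, a3⟩
    · left
      rw [hmom s l hl] at a3
      refine ⟨?_, (hinv _ _).1 a2, a3⟩
      funext i
      simpa using congrFun a1 (i + j)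
    · right
      rw [hmom s l hl] at a3
      refine ⟨funext ((hinv _ _).1 a1), fun i => ?_, a3⟩
      have := a2 (i + j)
      simpa [add_assoc] using this

/-- A trajectory that starts in a hexagon visits infinitely many hexagons, one after the other. The
visit times have no finite limit `T`, since the direction of the trajectory does not change just
before `T`, whereas it differs between consecutive visits. -/
lemma IsFlowLine.exists_visitSeq {q d : ℝ → Fin 3 → ℝ} (h : IsFlowLine q d) {t₀ : ℝ}
    {k₀ : Fin 3 → ℤ} (ht : InHex k₀ (q t₀)) (hD0 : 0 < d t₀ 0) (hD1 : 0 ≤ d t₀ 1)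
    (hm0 : 0 ≤ momentum k₀ (q t₀) (d t₀)) :
    ∃ t m k, IsVisitSeq q d (d t₀) t m k ∧ t 0 = t₀ ∧ k 0 = k₀ := by
  set D := d t₀ with hD
  let St : ℕ → ℝ × (Fin 3 → ℤ) → Prop := fun n x => InHex x.2 (q x.1) ∧
    (∀ i, d x.1 i = D (i + (n : Fin 3))) ∧ 0 ≤ momentum x.2 (q x.1) (d x.1)
  let M : ℝ × (Fin 3 → ℤ) → ℝ := fun x => momentum x.2 (q x.1) (d x.1)
  have hstep : ∀ n x, St n x → ∃ y, St (n + 1) y ∧ x.1 < y.1 ∧ 0 < M x ∧ M x < D 0 + D 1 ∧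
      ((M x < D 1 ∧ M y = M x + D 0 ∧ ∀ i, y.2 i = x.2 i + lowStep (i + (n : Fin 3))) ∨
        (D 1 < M x ∧ M y = M x - D 1 ∧ ∀ i, y.2 i = x.2 i + highStep (i + (n : Fin 3)))) ∧
      ∀ s, x.1 ≤ s → s ≤ y.1 → ∀ l, InHex l (q s) →
        (l = x.2 ∧ (∀ i, d s i = D (i + (n : Fin 3))) ∧ momentum l (q s) (d s) = M x) ∨
        (l = y.2 ∧ (∀ i, d s i = D (i + ((n + 1 : ℕ) : Fin 3))) ∧ momentum l (q s) (d s) = M y) := by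
    rintro n ⟨s₀, l₀⟩ ⟨h1, h2, h3⟩
    obtain ⟨a1, a2, t', ht', k', m', a3, a4, a5⟩ := h.hex_step_rotated (n : Fin 3) h1 h2 hD0 hD1 rfl h3
    have hlt : s₀ < t' := ht'
    -- The final state is not the initial one, as the centers differ.
    have hne : k' ≠ l₀ := by
      rintro rfl
      rcases a3 with ⟨-, -, a3⟩ | ⟨-, -, a3⟩
      · have := a3 (-(n : Fin 3))
        simp [lowStep] at this
      · have := a3 (-(n : Fin 3))
        simp [highStep] at this
    obtain ⟨-, b1, b2⟩ := (a5 t' hlt.le le_rfl k' a4).resolve_left fun hc => hne hc.1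
    have hm' : 0 ≤ m' := by
      rcases a3 with ⟨-, rfl, -⟩ | ⟨_, rfl, -⟩
      · linarith
      · linarith
    refine ⟨(t', k'), ⟨a4, fun i => ?_, ?_⟩, hlt, a1, a2, ?_, fun s hs1 hs2 l hl => ?_⟩
    · rw [b1 i]; push_cast; rfl
    · rw [b2]; exact hm'
    · simp only [M]
      rw [b2]
      exact a3
    · simp only [M]
      rw [b2]
      push_cast
      exact a5 s hs1 hs2 l hl
  choose! g hg1 hg2 hg3 hg4 hg5 hg6 using hstep
  let f : ℕ → ℝ × (Fin 3 → ℤ) := fun n => Nat.rec (t₀, k₀) g n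
  have hf : ∀ n, St n (f n) := by
    intro n
    induction n with
    | zero => exact ⟨ht, fun i => by simp [hD, f], hm0⟩
    | succ n ih => exact hg1 n _ ih
  have hmono : StrictMono fun n => (f n).1 := strictMono_nat_of_lt_succ fun n => hg2 n _ (hf n)
  have hunb : ∀ B, ∃ n, B < (f n).1 := by
    by_contra! hB
    obtain ⟨B, hB⟩ := hB
    have hlim := tendsto_atTop_ciSup hmono.monotone ⟨B, by rintro _ ⟨n, rfl⟩; exact hB n⟩
    set T := ⨆ n, (f n).1
    have hltT : ∀ n, (f n).1 < T := fun n =>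
      lt_of_lt_of_le (hmono (Nat.lt_succ_self n)) (hmono.monotone.ge_of_tendsto hlim (n + 1))
    obtain ⟨e, -, hl, -⟩ := h.flows T
    have hlim' : Tendsto (fun n => (f n).1) atTop (𝓝[<] T) :=
      tendsto_nhdsWithin_iff.2 ⟨hlim, Eventually.of_forall hltT⟩
    obtain ⟨n, hn⟩ := eventually_atTop.1 (hlim'.eventually hl)
    have e1 := (hn n le_rfl).2
    have e2 := (hn (n + 1) (Nat.le_succ n)).2
    have hc : ∀ i, D (i + (n : Fin 3)) = D (i + (n : Fin 3) + 1) := by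
      intro i
      rw [← (hf n).2.1 i, e1, ← e2, (hf (n + 1)).2.1 i]
      push_cast
      rw [add_assoc]
    have h01 := hc (-(n : Fin 3))
    have h12 := hc (1 - (n : Fin 3))
    have hs := h.sum_dir t₀
    simp only [neg_add_cancel, zero_add, sub_add_cancel, Fin.reduceAdd] at h01 h12
    rw [← hD] at hs
    linarith
  refine ⟨fun n => (f n).1, fun n => M (f n), fun n => (f n).2, ⟨⟨fun n => hg3 n _ (hf n),
    fun n => hg4 n _ (hf n), fun n => hg5 n _ (hf n)⟩, hmono, fun n => (hf n).1,
    fun n => (hf n).2.1, fun n => rfl, fun s hs l hl => ?_⟩, rfl, rfl⟩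
  obtain ⟨n, hn1, hn2⟩ : ∃ n, (f n).1 ≤ s ∧ s ≤ (f (n + 1)).1 := by
    obtain ⟨p, hp⟩ := hunb s
    induction p with
    | zero => exact absurd hp (not_lt.2 hs)
    | succ p ih =>
      rcases le_or_gt (f p).1 s with hle | hgt
      · exact ⟨p, hle, hp.le⟩
      · exact ih hgt
  have hlast : ∀ j, (f (j + 1)).1 ≤ s → j ≤ n := fun j hj =>
    Nat.le_of_succ_le_succ (hmono.le_iff_le.1 (hj.trans hn2))
  rcases hg6 n _ (hf n) s hn1 hn2 l hl with ⟨b1, b2, b3⟩ | ⟨b1, b2, b3⟩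
  · exact ⟨n, b1, b2, b3, hlast⟩
  · exact ⟨n + 1, b1, b2, b3, fun j hj => (hlast j hj).trans (Nat.le_succ n)⟩

/-! ### Recurrence -/

lemma isOddInt_add_two_mul {x : ℝ} (n : ℤ) : IsOddInt (x + 2 * n) ↔ IsOddInt x := by
  constructor
  · rintro ⟨a, ha⟩
    exact ⟨a - n, by push_cast; linarith⟩
  · rintro ⟨a, rfl⟩
    exact ⟨a + n, by push_cast; ring⟩

/-- The coordinates of the translation between two hexagon centers whose halved coordinates differ
by `κ`. -/
def shift (κ : Fin 3 → ℤ) : Fin 3 → ℝ := fun i => 2 * κ i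

lemma Refracts.translate {p d e : Fin 3 → ℝ} (h : Refracts p d e) (κ : Fin 3 → ℤ) :
    Refracts (p + shift κ) d e := by
  rcases h with ⟨h1, rfl⟩ | ⟨i, hi, h2, h3, h4⟩
  · exact Or.inl ⟨fun i => by simpa [shift, isOddInt_add_two_mul] using h1 i, rfl⟩
  · exact Or.inr ⟨i, by simpa [shift, isOddInt_add_two_mul] using hi,
      fun j hj => by simpa [shift, isOddInt_add_two_mul] using h2 j hj, h3, h4⟩

lemma FlowsAt.translate {q d : ℝ → Fin 3 → ℝ} {t : ℝ} (h : FlowsAt q d t) (κ : Fin 3 → ℤ) :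
    FlowsAt (fun s => q s + shift κ) d t := by
  obtain ⟨e, hr, hl, hw⟩ := h
  refine ⟨e, ?_, ?_, hw.translate κ⟩
  · filter_upwards [hr] with r ⟨h1, h2⟩
    rw [h1]
    exact ⟨by module, h2⟩
  · filter_upwards [hl] with r ⟨h1, h2⟩
    rw [h1]
    exact ⟨by module, h2⟩

lemma FlowsAt.comp_add {q d : ℝ → Fin 3 → ℝ} {t P : ℝ} (h : FlowsAt q d (t + P)) :
    FlowsAt (fun s => q (s + P)) (fun s => d (s + P)) t := by
  obtain ⟨e, hr, hl, hw⟩ := h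
  have hcont : Tendsto (fun s => s + P) (𝓝 t) (𝓝 (t + P)) :=
    (continuous_id.add continuous_const).tendsto t
  have h1 : Tendsto (fun s => s + P) (𝓝[≥] t) (𝓝[≥] (t + P)) :=
    tendsto_nhdsWithin_iff.2 ⟨hcont.mono_left nhdsWithin_le_nhds,
      eventually_mem_nhdsWithin.mono fun s hs => add_le_add_left (mem_Ici.1 hs) P⟩
  have h2 : Tendsto (fun s => s + P) (𝓝[<] t) (𝓝[<] (t + P)) :=
    tendsto_nhdsWithin_iff.2 ⟨hcont.mono_left nhdsWithin_le_nhds,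
      eventually_mem_nhdsWithin.mono fun s hs => add_lt_add_left (mem_Iio.1 hs) P⟩
  refine ⟨e, ?_, ?_, hw⟩
  · filter_upwards [h1.eventually hr] with r hr
    rwa [add_sub_add_right_eq_sub] at hr
  · filter_upwards [h2.eventually hl] with r hr
    rwa [add_sub_add_right_eq_sub] at hr

lemma IsFlowLine.recurrent {q d : ℝ → Fin 3 → ℝ} (h : IsFlowLine q d) {t t' : ℝ} {κ : Fin 3 → ℤ}
    (hq : q t' = q t + shift κ) (hd : d t' = d t) (s : ℝ) :
    q (s + (t' - t)) = q s + shift κ ∧ d (s + (t' - t)) = d s :=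
  flow_unique ordConnected_univ (fun s _ => (h.flows (s + (t' - t))).comp_add)
    (fun s _ => (h.flows s).translate κ) (mem_univ t) (by simpa using hq) (by simpa using hd)
    (mem_univ s)

lemma InHex.translate {k κ : Fin 3 → ℤ} {p : Fin 3 → ℝ} (h : InHex k p)
    (hκ : κ 0 + κ 1 + κ 2 = 0) : InHex (k + κ) (p + shift κ) := by
  refine ⟨?_, fun i => ?_⟩
  · have := h.1
    simp only [Pi.add_apply]; omega
  · convert h.2 i using 2
    simp only [Pi.add_apply, shift]; push_cast; ring

lemma momentum_translate (k κ : Fin 3 → ℤ) (p d : Fin 3 → ℝ) :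
    momentum (k + κ) (p + shift κ) d = momentum k p d := by
  simp only [momentum, Pi.add_apply, shift]; push_cast; ring

/-- A particle in a hexagon moves straight to any point of the hexagon ahead of it. -/
lemma IsFlowLine.straight_in_hex {q d : ℝ → Fin 3 → ℝ} (h : IsFlowLine q d) {t c : ℝ} (hc : 0 ≤ c)
    {k : Fin 3 → ℤ} (hk : InHex k (q t)) (hk' : InHex k (q t + c • d t)) :
    q (t + c) = q t + c • d t ∧ ∀ s, t ≤ s → s ≤ t + c → d s = d t := by
  rcases hc.eq_or_lt with rfl | hc
  · refine ⟨by simp, fun s hs1 hs2 => ?_⟩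
    rw [le_antisymm (by simpa using hs2) hs1]
  obtain ⟨h1, h2, h3⟩ := FlowsAt.straight h.flows (t := t) (T := t + c) (by linarith) (by
    intro s hs1 hs2 i
    refine not_isOddInt_of_abs_lt (a := k i) ?_
    have a1 := hk.2 i
    have a2 := hk'.2 i
    simp only [Pi.add_apply, Pi.smul_apply, smul_eq_mul] at a2
    rw [abs_lt] at a1 a2 ⊢
    rcases le_or_gt 0 (d t i) with hd | hd
    · have b1 : 0 ≤ (s - t) * d t i := mul_nonneg (by linarith) hd
      have b2 : 0 ≤ (c - (s - t)) * d t i := mul_nonneg (by linarith) hd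
      constructor <;> linarith
    · have b1 : 0 ≤ (s - t) * -d t i := mul_nonneg (by linarith) (by linarith)
      have b2 : 0 ≤ (c - (s - t)) * -d t i := mul_nonneg (by linarith) (by linarith)
      constructor <;> linarith)
  rw [add_sub_cancel_left] at h2
  refine ⟨h2, fun s hs1 hs2 => ?_⟩
  rcases hs2.eq_or_lt with rfl | hs2
  · rcases h3 with ⟨-, h3⟩ | ⟨i, hi, -⟩
    · exact h3.symm
    · rw [h2] at hi
      exact absurd hi (hk'.not_odd i)
  · exact (h1 s hs1 hs2).2

lemma rotated_ne {D : Fin 3 → ℝ} (hD0 : 0 < D 0) (hD : D 0 + D 1 + D 2 = 0) {j : Fin 3}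
    (h : ∀ i, D (i + j) = D i) : j = 0 := by
  have h0 := h 0
  have h1 := h 1
  have h2 := h 2
  fin_cases j
  · rfl
  · simp at h0 h1
    linarith
  · simp at h0 h2
    have : D 1 = D 2 := by simpa using h2
    linarith

/-- If the `p`-th visit has the direction and the momentum of the first one, then the trajectory is
invariant under the translation between the two hexagons. -/
lemma IsVisitSeq.exists_period {q d : ℝ → Fin 3 → ℝ} {D : Fin 3 → ℝ} {t m : ℕ → ℝ}
    {k : ℕ → Fin 3 → ℤ} (hv : IsVisitSeq q d D t m k) (h : IsFlowLine q d) (hD0 : 0 < D 0)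
    {p : ℕ} (hp : 0 < p) (hp3 : 3 ∣ p) (hm : m p = m 0) {κ : Fin 3 → ℤ} (hκ : k p = k 0 + κ) :
    ∃ P > 0, ∀ s, q (s + P) = q s + shift κ ∧ d (s + P) = d s := by
  have hd0 : d (t 0) = D := by
    funext i
    simpa using hv.dir 0 i
  have hdp : d (t p) = D := by
    funext i
    have := hv.dir p i
    rwa [(natCast_eq_zero_iff_three_dvd p).2 hp3, add_zero] at this
  have hD := h.sum_dir (t 0)
  rw [hd0] at hD
  have hκ0 : κ 0 + κ 1 + κ 2 = 0 := by
    have h1 := (hv.inHex 0).1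
    have h2 := (hv.inHex p).1
    rw [hκ] at h2
    simp only [Pi.add_apply] at h2
    omega
  have hκ0' : (κ 0 + κ 1 + κ 2 : ℝ) = 0 := by exact_mod_cast hκ0
  have hin0 := hv.inHex 0
  have hinp := hv.inHex p
  -- Up to the translation, the two visits follow the same line in the same hexagon.
  obtain ⟨c, hc⟩ : ∃ c : ℝ, q (t p) = q (t 0) + c • D + shift κ := by
    have h1 := hv.momentum_eq 0
    have h2 := hv.momentum_eq p
    rw [hm, ← h1, hdp, hd0, hκ] at h2
    have s0 := h.sum_pos (t 0)
    have sp := h.sum_pos (t p)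
    simp only [momentum, Pi.add_apply] at h2
    push_cast at h2
    have hne := hD0.ne'
    refine ⟨(q (t p) 0 - 2 * κ 0 - q (t 0) 0) / D 0, ?_⟩
    have e0 : (q (t p) 0 - 2 * κ 0 - q (t 0) 0) / D 0 * D 0 = q (t p) 0 - 2 * κ 0 - q (t 0) 0 := by
      field_simp
    have e1 : (q (t p) 0 - 2 * κ 0 - q (t 0) 0) / D 0 * D 1 =
        q (t p) 1 - 2 * κ 1 - q (t 0) 1 := by
      field_simp
      linarith
    have e2 : (q (t p) 0 - 2 * κ 0 - q (t 0) 0) / D 0 * D 2 =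
        q (t p) 2 - 2 * κ 2 - q (t 0) 2 := by
      have : D 2 = -D 0 - D 1 := by linarith
      rw [this, mul_sub, mul_neg, e0, e1]
      linarith
    funext i
    simp only [Pi.add_apply, Pi.smul_apply, smul_eq_mul, shift]
    fin_cases i
    · simp only [Fin.zero_eta, e0]; ring
    · simp only [Fin.mk_one, e1]; ring
    · simp only [Fin.reduceFinMk, e2]; ring
  rcases le_or_gt c 0 with hneg | hpos
  · obtain ⟨a1, a2⟩ := h.straight_in_hex (t := t p) (c := -c) (by linarith) hinp (by
      rw [hκ, hdp, hc]
      convert hin0.translate hκ0 using 1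
      module)
    have a3 := a2 (t p + -c) (by linarith) le_rfl
    have hlt : t 0 < t p := hv.strictMono hp
    refine ⟨t p + -c - t 0, by linarith, h.recurrent ?_ ?_⟩
    · rw [a1, hdp, hc]; module
    · rw [a3, hdp, hd0]
  · obtain ⟨a1, a2⟩ := h.straight_in_hex (t := t 0) (c := c) hpos.le hin0 (by
      rw [hκ] at hinp
      have := hinp.translate (κ := -κ) (by simp only [Pi.neg_apply]; omega)
      rw [hc] at this
      rw [hd0]
      convert this using 1
      · simp
      · funext i
        simp only [Pi.add_apply, Pi.neg_apply, shift]; push_cast; ring)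
    have a3 := a2 (t 0 + c) (by linarith) le_rfl
    refine ⟨t p - (t 0 + c), ?_, h.recurrent ?_ ?_⟩
    · by_contra hle
      have h01 : t 0 < t 1 := hv.strictMono one_pos
      have h1p : t 1 ≤ t p := hv.strictMono.monotone hp
      have e := a2 (t 1) h01.le (by linarith)
      have : (1 : Fin 3) = 0 := rotated_ne hD0 hD fun i => by
        have := hv.dir 1 i
        rw [e, hd0] at this
        simpa using this.symm
      exact absurd this (by decide)
    · rw [a1, hd0, hc]
    · rw [a3, hdp, hd0]

/-- The direction `d` is a positive multiple of a primitive integer vector of hexagonal norm `N`. -/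
def IsRationalDir (d : Fin 3 → ℝ) (N : ℕ) : Prop :=
  ∃ r : ℝ, 0 < r ∧ ∃ w : Fin 3 → ℤ, (∀ i, d i = r * w i) ∧ (∀ g : ℤ, (∀ i, g ∣ w i) → IsUnit g) ∧
    (∀ i, |w i| ≤ N) ∧ ∃ i, |w i| = N

lemma IsRationalDir.comp_perm {d : Fin 3 → ℝ} {N : ℕ} (h : IsRationalDir d N)
    (σ : Equiv.Perm (Fin 3)) : IsRationalDir (d ∘ σ) N := by
  obtain ⟨r, hr, w, h1, h2, h3, i, hi⟩ := h
  refine ⟨r, hr, w ∘ σ, fun i => h1 _, fun g hg => h2 g fun i => ?_, fun i => h3 _, σ.symm i, ?_⟩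
  · simpa using hg (σ.symm i)
  · simpa using hi

lemma IsRationalDir.neg {d : Fin 3 → ℝ} {N : ℕ} (h : IsRationalDir d N) : IsRationalDir (-d) N := by
  obtain ⟨r, hr, w, h1, h2, h3, i, hi⟩ := h
  refine ⟨r, hr, -w, fun i => ?_, fun g hg => h2 g fun i => ?_, fun i => ?_, i, ?_⟩
  · simp [h1]
  · simpa using hg i
  · simpa using h3 i
  · simpa using hi

lemma isRationalDir_of_coprime {d : Fin 3 → ℝ} (hd : d 0 + d 1 + d 2 = 0) {r : ℝ} (hr : 0 < r)
    {x y : ℕ} (hxy : x.Coprime y) (h0 : d 0 = r * x) (h1 : d 1 = r * y) :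
    IsRationalDir d (x + y) := by
  refine ⟨r, hr, ![x, y, -(x + y)], fun i => ?_, fun g hg => ?_, fun i => ?_, 2, ?_⟩
  · fin_cases i
    · simpa using h0
    · simpa using h1
    · simp; linarith
  · have a0 : g ∣ x := by simpa using hg 0
    have a1 : g ∣ y := by simpa using hg 1
    exact (Nat.isCoprime_iff_coprime.2 hxy).isUnit_of_dvd' a0 a1
  · rw [abs_le]
    fin_cases i <;> simp
    all_goals omega
  · rw [abs_of_nonpos] <;> simp

lemma IsRationalDir.exists_coprime {d : Fin 3 → ℝ} {N : ℕ} (h : IsRationalDir d N)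
    (hd : d 0 + d 1 + d 2 = 0) (h0 : 0 < d 0) (h1 : 0 ≤ d 1) :
    ∃ r : ℝ, 0 < r ∧ ∃ x y : ℕ, x.Coprime y ∧ d 0 = r * x ∧ d 1 = r * y ∧ x + y = N := by
  obtain ⟨r, hr, w, e, hprim, hle, i, hi⟩ := h
  have w0 : 0 ≤ w 0 := by
    rw [e 0] at h0
    exact_mod_cast (pos_of_mul_pos_right h0 hr.le).le
  have w1 : 0 ≤ w 1 := by
    rw [e 1] at h1
    exact_mod_cast nonneg_of_mul_nonneg_right h1 hr
  have hw : w 0 + w 1 + w 2 = 0 := by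
    rw [e 0, e 1, e 2, ← mul_add, ← mul_add] at hd
    exact_mod_cast (mul_eq_zero.1 hd).resolve_left hr.ne'
  lift w 0 to ℕ using w0 with x hx
  lift w 1 to ℕ using w1 with y hy
  refine ⟨r, hr, x, y, ?_, ?_, ?_, ?_⟩
  · rw [← Nat.isCoprime_iff_coprime, Int.isCoprime_iff_gcd_eq_one]
    have a0 : ((Int.gcd x y : ℕ) : ℤ) ∣ x := Int.gcd_dvd_left ..
    have a1 : ((Int.gcd x y : ℕ) : ℤ) ∣ y := Int.gcd_dvd_right ..
    have := hprim (Int.gcd x y) fun i => by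
      fin_cases i
      · simpa [← hx] using a0
      · simpa [← hy] using a1
      · have a2 := dvd_neg.2 (dvd_add a0 a1)
        have : w 2 = -((x : ℤ) + y) := by omega
        simpa [this] using a2
    rw [Int.isUnit_iff] at this
    omega
  · rw [e 0, ← hx]; simp
  · rw [e 1, ← hy]; simp
  · have h2 := hle 2
    have : w 2 = -((x : ℤ) + y) := by omega
    rw [this, abs_neg] at h2
    have h2' := (abs_le.1 h2).2
    fin_cases i
    · have hi : |w 0| = N := hi
      rw [← hx, abs_of_nonneg (by omega)] at hi
      omega
    · have hi : |w 1| = N := hi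
      rw [← hy, abs_of_nonneg (by omega)] at hi
      omega
    · have hi : |w 2| = N := hi
      rw [this, abs_neg, abs_of_nonneg (by omega)] at hi
      omega

/-- By the symmetries of the tiling that fix the origin, the direction in a hexagon may be assumed to
lie in one sector of angle `π / 3`, and the momentum to be nonnegative. -/
lemma flowLine_induction {t : ℝ} {C : (ℝ → Fin 3 → ℝ) → (ℝ → Fin 3 → ℝ) → (Fin 3 → ℤ) → Prop}
    (perm : ∀ q d k (σ : Equiv.Perm (Fin 3)), IsFlowLine q d → InHex k (q t) →
      C (fun s => q s ∘ σ) (fun s => d s ∘ σ) (k ∘ σ) → C q d k)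
    (neg : ∀ q d k, C (fun s => -q s) (fun s => -d s) (-k) → C q d k)
    (sector : ∀ q d k, IsFlowLine q d → InHex k (q t) → 0 < d t 0 → 0 ≤ d t 1 →
      0 ≤ momentum k (q t) (d t) → C q d k)
    {q d : ℝ → Fin 3 → ℝ} {k : Fin 3 → ℤ} (h : IsFlowLine q d) (hk : InHex k (q t)) : C q d k := by
  have nonneg : ∀ q d k, IsFlowLine q d → InHex k (q t) → 0 ≤ momentum k (q t) (d t) →
      C q d k := by
    intro q d k h hk hm
    have hsum := h.sum_dir t
    obtain ⟨j, hj⟩ : ∃ j : Fin 3, (0 < d t j ∧ 0 ≤ d t (1 + j)) ∨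
        (d t j < 0 ∧ d t (1 + j) ≤ 0) := by
      by_contra! hno
      obtain ⟨a1, a2⟩ := hno 0
      obtain ⟨b1, b2⟩ := hno 1
      obtain ⟨c1, c2⟩ := hno 2
      simp only [Fin.reduceAdd] at a1 a2 b1 b2 c1 c2
      rcases lt_trichotomy (d t 0) 0 with h0 | h0 | h0
      · have := a2 h0
        have := b1 this
        have := c2 this
        linarith
      · rcases lt_trichotomy (d t 1) 0 with h1 | h1 | h1
        · have := c1 (b2 h1)
          linarith
        · refine h.dir_ne t (funext fun i => ?_)
          fin_cases i
          · exact h0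
          · exact h1
          · simp only [Fin.reduceFinMk, Pi.zero_apply]; linarith
        · have := c2 (b1 h1)
          linarith
      · have := a1 h0
        have := b2 this
        have := c1 this
        linarith
    refine perm q d k (Equiv.addRight j) h hk ?_
    have h' := h.comp_perm (Equiv.addRight j)
    have hk' := hk.comp_perm (Equiv.addRight j)
    rw [← momentum_addRight hk.1 (h.sum_pos t) hsum j] at hm
    rcases hj with ⟨h0, h1⟩ | ⟨h0, h1⟩
    · exact sector _ _ _ h' hk' (by simpa using h0) h1 hm
    · refine neg _ _ _ (sector _ _ _ h'.neg hk'.neg (by simpa using h0) (by simpa using h1) ?_)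
      rw [momentum_neg]
      exact hm
  rcases le_or_gt 0 (momentum k (q t) (d t)) with hm | hm
  · exact nonneg q d k h hk hm
  · refine perm q d k (Equiv.swap 0 1) h hk (nonneg _ _ _ (h.comp_perm _) (hk.comp_perm _) ?_)
    simp only [momentum, Function.comp_apply, Equiv.swap_apply_left, Equiv.swap_apply_right] at hm ⊢
    linarith

lemma exists_momentum_comp_perm (σ : Equiv.Perm (Fin 3)) : ∃ ε : ℝ, ε * ε = 1 ∧
    ∀ (k : Fin 3 → ℤ) (p d : Fin 3 → ℝ), k 0 + k 1 + k 2 = 0 → p 0 + p 1 + p 2 = 0 →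
      d 0 + d 1 + d 2 = 0 → momentum (k ∘ σ) (p ∘ σ) (d ∘ σ) = ε * momentum k p d := by
  have hσ : ∀ σ : Equiv.Perm (Fin 3), ∃ j, σ = Equiv.addRight j ∨
      σ = (Equiv.addRight j).trans (Equiv.swap 0 1) := by decide
  obtain ⟨j, rfl | rfl⟩ := hσ σ
  · exact ⟨1, by norm_num, fun k p d hk hp hd => by rw [momentum_addRight hk hp hd, one_mul]⟩
  · refine ⟨-1, by norm_num, fun k p d hk hp hd => ?_⟩
    rw [Equiv.coe_trans, ← Function.comp_assoc, ← Function.comp_assoc, ← Function.comp_assoc,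
      momentum_addRight (sum_comp_perm_eq_zero hk _) (sum_comp_perm_eq_zero hp _)
        (sum_comp_perm_eq_zero hd _)]
    simp only [momentum, Function.comp_apply, Equiv.swap_apply_left, Equiv.swap_apply_right]
    ring

lemma shift_neg (κ : Fin 3 → ℤ) : shift (-κ) = -shift κ := by
  funext i
  simp [shift]

lemma shift_zero : shift 0 = 0 := by
  funext i
  simp [shift]

/-- After `P` time units the trajectory is translated by the vector with coordinates `2 * κ`. -/
def IsTranslatedBy (q d : ℝ → Fin 3 → ℝ) (P : ℝ) (κ : Fin 3 → ℤ) : Prop :=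
  ∀ s, q (s + P) = q s + shift κ ∧ d (s + P) = d s

lemma IsTranslatedBy.comp_perm {q d : ℝ → Fin 3 → ℝ} {P : ℝ} {κ : Fin 3 → ℤ}
    (h : IsTranslatedBy q d P κ) (σ : Equiv.Perm (Fin 3)) :
    IsTranslatedBy (fun s => q s ∘ σ) (fun s => d s ∘ σ) P (κ ∘ σ) := by
  intro s
  beta_reduce
  rw [(h s).1, (h s).2]
  exact ⟨rfl, rfl⟩

lemma IsTranslatedBy.neg {q d : ℝ → Fin 3 → ℝ} {P : ℝ} {κ : Fin 3 → ℤ}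
    (h : IsTranslatedBy q d P κ) : IsTranslatedBy (fun s => -q s) (fun s => -d s) P (-κ) := by
  intro s
  beta_reduce
  rw [(h s).1, (h s).2, shift_neg]
  exact ⟨by module, rfl⟩

lemma IsTranslatedBy.mul {q d : ℝ → Fin 3 → ℝ} {P : ℝ} {κ : Fin 3 → ℤ}
    (h : IsTranslatedBy q d P κ) (n : ℕ) : IsTranslatedBy q d (n * P) (n • κ) := by
  induction n with
  | zero =>
    intro s
    simp [shift_zero]
  | succ n ih =>
    intro s
    have e : s + (n + 1 : ℕ) * P = s + n * P + P := by push_cast; ring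
    rw [e, (h _).1, (h _).2, (ih s).1, (ih s).2]
    refine ⟨?_, rfl⟩
    funext i
    simp only [Pi.add_apply, shift, nsmul_eq_mul, Pi.mul_apply]
    simp
    ring

/-- A trajectory in a rational direction is periodic or drift-periodic, according to the hexagonal
norm of the direction. -/
theorem IsFlowLine.exists_translatedBy {q d : ℝ → Fin 3 → ℝ} {k : Fin 3 → ℤ} {t : ℝ} {N : ℕ}
    (h : IsFlowLine q d) (hk : InHex k (q t)) (hN : IsRationalDir (d t) N) :
    ∃ P > 0, ∃ κ : Fin 3 → ℤ, IsTranslatedBy q d P κ ∧ (κ = 0 ↔ ¬ 3 ∣ N) := by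
  revert hN
  refine flowLine_induction (t := t) (C := fun q d _ => IsRationalDir (d t) N →
    ∃ P > 0, ∃ κ : Fin 3 → ℤ, IsTranslatedBy q d P κ ∧ (κ = 0 ↔ ¬ 3 ∣ N)) ?_ ?_ ?_ h hk
  · intro q d _ σ _ _ hC hN
    obtain ⟨P, hP, κ, h1, h2⟩ := hC (hN.comp_perm σ)
    refine ⟨P, hP, κ ∘ σ.symm, ?_, ?_⟩
    · have := h1.comp_perm σ.symm
      simpa [Function.comp_assoc] using this
    · rw [← h2]
      constructor
      · intro h0
        funext i
        simpa using congrFun h0 (σ i)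
      · rintro rfl
        rfl
  · intro q d _ hC hN
    obtain ⟨P, hP, κ, h1, h2⟩ := hC hN.neg
    refine ⟨P, hP, -κ, ?_, by simpa using h2⟩
    simpa using h1.neg
  · intro q d k h hk h0 h1 hm hN
    obtain ⟨r, hr, x, y, hxy, e0, e1, rfl⟩ := hN.exists_coprime (h.sum_dir t) h0 h1
    obtain ⟨τ, m, c, hv, rfl, rfl⟩ := h.exists_visitSeq hk h0 h1 hm
    have hit := hv.itinerary
    rw [e0, e1] at hit
    have hpos : 0 < x + y := by
      rcases Nat.eq_zero_or_pos x with rfl | hx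
      · simp [e0] at h0
      · omega
    by_cases h3 : 3 ∣ x + y
    · obtain ⟨κ, hκ, hdrift⟩ := hit.exists_drift hr hxy h3
      have hd1 := hdrift 0 1
      simp only [zero_add, one_mul, one_smul] at hd1
      obtain ⟨P, hP, hP'⟩ := hv.exists_period h h0 hpos h3
        (by simpa using (hit.period hr 0).1) hd1
      exact ⟨P, hP, κ, hP', by simp [hκ, h3]⟩
    · have hc := hit.center_periodic hr h3 0
      rw [zero_add] at hc
      obtain ⟨P, hP, hP'⟩ := hv.exists_period h h0 (p := 3 * (x + y)) (κ := 0) (by omega)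
        (dvd_mul_right _ _) (by simpa using hit.period_mul hr 0 3) (by simpa using hc)
      exact ⟨P, hP, 0, hP', by simp [h3]⟩

lemma IsTranslatedBy.sum_eq_zero {q d : ℝ → Fin 3 → ℝ} {P : ℝ} {κ : Fin 3 → ℤ}
    (hP : IsTranslatedBy q d P κ) (h : IsFlowLine q d) : κ 0 + κ 1 + κ 2 = 0 := by
  have h1 := h.sum_pos (0 + P)
  have h2 := h.sum_pos 0
  rw [(hP 0).1] at h1
  simp only [Pi.add_apply, shift] at h1
  have : (κ 0 + κ 1 + κ 2 : ℝ) = 0 := by linarith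
  exact_mod_cast this

/-- A periodic or drift-periodic trajectory has a rational direction, whose hexagonal norm tells
which of the two it is. All its visits to hexagons have the same sense of rotation, and their
directions differ by rotations of the coordinates. -/
theorem IsFlowLine.isRationalDir_of_translatedBy {q d : ℝ → Fin 3 → ℝ} {k κ : Fin 3 → ℤ} {t P : ℝ}
    (h : IsFlowLine q d) (hk : InHex k (q t)) (hP0 : 0 < P) (hP : IsTranslatedBy q d P κ) :
    (∃ N, IsRationalDir (d t) N ∧ (κ = 0 ↔ ¬ 3 ∣ N)) ∧ ∀ s l, InHex l (q s) →
      (∃ j, ∀ i, d s i = d t (i + j)) ∧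
        0 < momentum l (q s) (d s) * momentum k (q t) (d t) := by
  revert hP
  refine flowLine_induction (t := t) (C := fun q d k => ∀ κ : Fin 3 → ℤ, IsTranslatedBy q d P κ →
    (∃ N, IsRationalDir (d t) N ∧ (κ = 0 ↔ ¬ 3 ∣ N)) ∧ ∀ s l, InHex l (q s) →
      (∃ j, ∀ i, d s i = d t (i + j)) ∧
        0 < momentum l (q s) (d s) * momentum k (q t) (d t))
    ?_ ?_ ?_ h hk _
  · intro q d k σ h hk hC κ hP
    obtain ⟨⟨N, hN, hκ⟩, hC⟩ := hC _ (hP.comp_perm σ)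
    refine ⟨⟨N, ?_, ?_⟩, fun s l hl => ?_⟩
    · simpa [Function.comp_assoc] using hN.comp_perm σ.symm
    · rw [← hκ]
      constructor
      · rintro rfl
        rfl
      · intro h0
        funext i
        simpa using congrFun h0 (σ.symm i)
    · obtain ⟨⟨j, hj⟩, hm⟩ := hC s _ (hl.comp_perm σ)
      have hσ : ∀ (σ : Equiv.Perm (Fin 3)) (j : Fin 3),
          ∃ j', ∀ i, σ (σ.symm i + j) = i + j' := by decide
      obtain ⟨j', hj'⟩ := hσ σ j
      refine ⟨⟨j', fun i => ?_⟩, ?_⟩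
      · rw [← hj' i]
        simpa using hj (σ.symm i)
      · obtain ⟨ε, hε, hmom⟩ := exists_momentum_comp_perm σ
        rw [hmom _ _ _ hl.1 (h.sum_pos s) (h.sum_dir s), hmom _ _ _ hk.1 (h.sum_pos t)
          (h.sum_dir t), mul_mul_mul_comm, hε, one_mul] at hm
        exact hm
  · intro q d k hC κ hP
    obtain ⟨⟨N, hN, hκ⟩, hC⟩ := hC _ hP.neg
    refine ⟨⟨N, by simpa using hN.neg, by simpa using hκ⟩, fun s l hl => ?_⟩
    obtain ⟨⟨j, hj⟩, hm⟩ := hC s _ hl.neg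
    rw [momentum_neg, momentum_neg] at hm
    exact ⟨⟨j, fun i => by simpa using hj i⟩, hm⟩
  · intro q d k h hk h0 h1 hm κ hP
    have hsum := hP.sum_eq_zero h
    obtain ⟨τ, m, c, hv, rfl, rfl⟩ := h.exists_visitSeq hk h0 h1 hm
    have hit := hv.itinerary
    have htrans : ∀ (n : ℕ) s l, InHex l (q s) → InHex (l + n • κ) (q (s + n * P)) ∧
        momentum (l + n • κ) (q (s + n * P)) (d (s + n * P)) = momentum l (q s) (d s) := by
      intro n s l hl
      rw [(hP.mul n s).1, (hP.mul n s).2, momentum_translate]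
      exact ⟨hl.translate ((hP.mul n).sum_eq_zero h), rfl⟩
    refine ⟨?_, fun s l hl => ?_⟩
    · -- A multiple of the period is so long that at least one more hexagon is visited.
      obtain ⟨n, hn⟩ := exists_nat_gt ((τ 2 - τ 0) / P)
      rw [div_lt_iff₀ hP0] at hn
      have h02 : τ 0 < τ 2 := hv.strictMono two_pos
      have hn0 : n ≠ 0 := by
        rintro rfl
        simp at hn
        linarith
      obtain ⟨a1, a2⟩ := htrans n (τ 0) _ hk
      obtain ⟨p, e1, e2, e3, e4⟩ := hv.cover (τ 0 + n * P) (by linarith) _ a1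
      have hp : 0 < p := e4 1 (by norm_num; linarith)
      have hp3 : 3 ∣ p := (natCast_eq_zero_iff_three_dvd p).1 (rotated_ne h0 (h.sum_dir _)
        fun i => by rw [← e2, (hP.mul n _).2])
      have hmp : m p = m 0 := by rw [← e3, a2, hv.momentum_eq]
      obtain ⟨r, hr, x, y, hxy, d0, d1, g, rfl⟩ := hit.exists_rational h0 h1 hp hmp
      rw [d0, d1] at hit
      refine ⟨x + y, isRationalDir_of_coprime (h.sum_dir _) hr hxy d0 d1, ?_⟩
      have hg : g ≠ 0 := by
        rintro rfl
        simp at hp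
      by_cases h3 : 3 ∣ x + y
      · obtain ⟨κ', hκ', hdrift⟩ := hit.exists_drift hr hxy h3
        have := hdrift 0 g
        rw [zero_add, mul_comm, ← e1, add_right_inj] at this
        simp only [h3, not_true, iff_false]
        rintro rfl
        rw [smul_zero] at this
        exact (smul_ne_zero hg hκ') this.symm
      · obtain ⟨g, rfl⟩ := (Nat.prime_three.dvd_mul.1 hp3).resolve_left h3
        have hc : ∀ g : ℕ, c ((x + y) * (3 * g)) = c 0 := by
          intro g
          induction g with
          | zero => simp
          | succ g ih => rw [← ih, ← hit.center_periodic hr h3 ((x + y) * (3 * g))]; congr 1; ring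
        rw [hc g, add_eq_left] at e1
        simp only [h3, not_false_eq_true, iff_true]
        exact (smul_eq_zero.1 e1).resolve_left hn0
    · obtain ⟨n, hn⟩ := exists_nat_gt ((τ 0 - s) / P)
      rw [div_lt_iff₀ hP0] at hn
      obtain ⟨a1, a2⟩ := htrans n s l hl
      obtain ⟨p, -, e2, e3, -⟩ := hv.cover (s + n * P) (by linarith) _ a1
      refine ⟨⟨p, fun i => by rw [← e2, (hP.mul n s).2]⟩, mul_pos ?_ ?_⟩
      · rw [← a2, e3]
        exact hit.pos p
      · rw [hv.momentum_eq]
        exact hit.pos 0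

/-! ### Hexagonal coordinates on the plane -/

/-- The hexagonal coordinates of `z`: the first two are the coordinates of `z` in the basis
`v 0`, `-v 2` of the Eisenstein lattice, and the sum of all three is zero. -/
def coord : ℂ →ₗ[ℝ] (Fin 3 → ℝ) where
  toFun z := ![z.re - z.im / √3, 2 * z.im / √3, -z.re - z.im / √3]
  map_add' z w := by
    funext i
    fin_cases i <;> simp <;> ring
  map_smul' r z := by
    funext i
    fin_cases i <;> simp <;> ring

lemma coord_zero (z : ℂ) : coord z 0 = z.re - z.im / √3 := rfl
lemma coord_one (z : ℂ) : coord z 1 = 2 * z.im / √3 := rfl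
lemma coord_two (z : ℂ) : coord z 2 = -z.re - z.im / √3 := rfl

lemma coord_sum (z : ℂ) : coord z 0 + coord z 1 + coord z 2 = 0 := by
  rw [coord_zero, coord_one, coord_two]; ring

lemma sqrt_three_ne_zero : √3 ≠ (0 : ℝ) := by positivity

lemma sqrt_three_mul_self : √3 * √3 = (3 : ℝ) := Real.mul_self_sqrt (by norm_num)

lemma im_eq_coord (z : ℂ) : z.im = √3 / 2 * coord z 1 := by
  rw [coord_one]
  field_simp [sqrt_three_ne_zero]

lemma re_eq_coord (z : ℂ) : z.re = coord z 0 + coord z 1 / 2 := by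
  rw [coord_zero, coord_one]; ring

lemma coord_injective : Function.Injective coord := fun z w h =>
  Complex.ext (by rw [re_eq_coord, re_eq_coord, h]) (by rw [im_eq_coord, im_eq_coord, h])

lemma coord_v_zero : coord (v 0) = ![1, 0, -1] := by
  funext i
  fin_cases i <;> simp [coord, v]

lemma coord_v_one : coord (v 1) = ![-1, 1, 0] := by
  have := sqrt_three_ne_zero
  funext i
  fin_cases i <;> simp [coord, v] <;> field_simp <;> norm_num

lemma coord_v_two : coord (v 2) = ![0, -1, 1] := by
  have := sqrt_three_ne_zero
  funext i
  fin_cases i <;> simp [coord, v] <;> field_simp <;> norm_num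

lemma coord_v (k i : Fin 3) : coord (v k) i = if i = k then 1 else if i = k + 1 then 0 else -1 := by
  fin_cases k <;> simp only [Fin.zero_eta, Fin.mk_one, Fin.reduceFinMk, coord_v_zero, coord_v_one,
    coord_v_two] <;> fin_cases i <;> rfl

lemma coord_v_self (i : Fin 3) : coord (v i) i = 1 := by simp [coord_v]

lemma coord_v_succ (i : Fin 3) : coord (v i) (i + 1) = 0 := by fin_cases i <;> simp [coord_v]

lemma coord_v_add_two (i : Fin 3) : coord (v i) (i + 2) = -1 := by fin_cases i <;> simp [coord_v]

lemma coord_v_succ_self (i : Fin 3) : coord (v (i + 1)) i = -1 := by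
  fin_cases i <;> simp [coord_v]

lemma coord_v_succ_add_two (i : Fin 3) : coord (v (i + 1)) (i + 2) = 0 := by
  fin_cases i <;> simp [coord_v]

/-- The rotations by multiples of `2π/3` permute the coordinates cyclically. -/
lemma coord_v_mul (k : Fin 3) (z : ℂ) (i : Fin 3) : coord (v k * z) i = coord z (i - k) := by
  have h3 := sqrt_three_mul_self
  have hne := sqrt_three_ne_zero
  fin_cases k
  · have : v 0 = 1 := Complex.ext rfl rfl
    simp [this]
  · fin_cases i
    · change coord _ 0 = coord z 2
      simp [coord, v]; field_simp; linear_combination (-z.im) * h3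
    · change coord _ 1 = coord z 0
      simp [coord, v]; field_simp; ring
    · change coord _ 2 = coord z 1
      simp [coord, v]; field_simp; linear_combination (z.im) * h3
  · fin_cases i
    · change coord _ 0 = coord z 1
      simp [coord, v]; field_simp; linear_combination (z.im) * h3
    · change coord _ 1 = coord z 2
      simp [coord, v]; field_simp; ring
    · change coord _ 2 = coord z 0
      simp [coord, v]; field_simp; linear_combination (-z.im) * h3

lemma cross_eq_coord (z w : ℂ) :
    z.re * w.im - z.im * w.re = √3 / 2 * (coord z 0 * coord w 1 - coord z 1 * coord w 0) := by
  rw [im_eq_coord z, im_eq_coord w, re_eq_coord z, re_eq_coord w]; ring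

/-- Every vector of coordinates with sum zero belongs to a point. -/
lemma exists_coord_eq {f : Fin 3 → ℝ} (hf : f 0 + f 1 + f 2 = 0) : ∃ z, coord z = f := by
  refine ⟨f 0 • v 0 - f 1 • v 2, ?_⟩
  rw [map_sub, map_smul, map_smul, coord_v_zero, coord_v_two]
  funext i
  fin_cases i
  · simp
  · simp
  · change _ = f 2
    simp
    linarith

lemma mem_eisensteinLattice_iff {z : ℂ} :
    z ∈ eisensteinLattice ↔ ∃ w : Fin 3 → ℤ, ∀ i, coord z i = w i := by
  constructor
  · intro hz
    refine AddSubgroup.closure_induction (p := fun z _ => ∃ w : Fin 3 → ℤ, ∀ i, coord z i = w i)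
      ?_ ⟨0, by simp⟩ ?_ ?_ hz
    · rintro _ ⟨k, rfl⟩
      refine ⟨fun i => if i = k then 1 else if i = k + 1 then 0 else -1, fun i => ?_⟩
      rw [coord_v]
      push_cast
      rfl
    · rintro x y _ _ ⟨a, ha⟩ ⟨b, hb⟩
      exact ⟨a + b, fun i => by simp [ha, hb]⟩
    · rintro x _ ⟨a, ha⟩
      exact ⟨-a, fun i => by simp [ha]⟩
  · rintro ⟨w, hw⟩
    have : z = w 0 • v 0 - w 1 • v 2 := by
      apply coord_injective
      rw [map_sub, map_zsmul, map_zsmul, coord_v_zero, coord_v_two]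
      have hs := coord_sum z
      rw [hw 0, hw 1] at hs
      funext i
      fin_cases i
      · simp [hw]
      · simp [hw]
      · change coord z 2 = _
        simp
        linarith
    rw [this]
    exact sub_mem (zsmul_mem (AddSubgroup.subset_closure (mem_range_self _)) _)
      (zsmul_mem (AddSubgroup.subset_closure (mem_range_self _)) _)

lemma mem_centers_iff {c : ℂ} :
    c ∈ centers ↔ ∃ k : Fin 3 → ℤ, k 0 + k 1 + k 2 = 0 ∧ coord c = shift k := by
  have htwo : ∀ l : ℂ, coord (2 * l) = (2 : ℝ) • coord l := by
    intro l
    rw [← map_smul]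
    congr 1
  constructor
  · rintro ⟨l, hl, rfl⟩
    obtain ⟨k, hk⟩ := mem_eisensteinLattice_iff.1 hl
    refine ⟨k, ?_, ?_⟩
    · have := coord_sum l
      rw [hk, hk, hk] at this
      exact_mod_cast this
    · rw [htwo]
      funext i
      simp [shift, hk]
  · rintro ⟨k, -, hk⟩
    refine ⟨c / 2, mem_eisensteinLattice_iff.2 ⟨k, fun i => ?_⟩, by ring⟩
    have h := htwo (c / 2)
    rw [mul_div_cancel₀ _ two_ne_zero, hk] at h
    have := congrFun h i
    simp only [shift, Pi.smul_apply, smul_eq_mul] at this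
    linarith

lemma exists_center {k : Fin 3 → ℤ} (hk : k 0 + k 1 + k 2 = 0) :
    ∃ c ∈ centers, coord c = shift k := by
  have hk' : (k 0 + k 1 + k 2 : ℝ) = 0 := by exact_mod_cast hk
  obtain ⟨c, hc⟩ := exists_coord_eq (f := shift k) (by simp only [shift]; linarith)
  exact ⟨c, mem_centers_iff.2 ⟨k, hk, hc⟩, hc⟩

/-! ### The tiles and edges in coordinates -/

/-- A closed bound on a linear functional that holds on a set is strict in its interior. -/
lemma lt_of_mem_interior {S : Set ℂ} {f : ℂ →ₗ[ℝ] ℝ} {a : ℝ} (hS : ∀ z ∈ S, f z ≤ a) {w : ℂ}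
    (hw : 0 < f w) {p : ℂ} (hp : p ∈ interior S) : f p < a := by
  have hcont : Tendsto (fun s : ℝ => p + s • w) (𝓝[>] 0) (𝓝 p) := by
    have : ContinuousAt (fun s : ℝ => p + s • w) 0 := by fun_prop
    have h := this.tendsto
    simp only [zero_smul, add_zero] at h
    exact h.mono_left nhdsWithin_le_nhds
  obtain ⟨s, hs, hs0⟩ := ((hcont.eventually (mem_interior_iff_mem_nhds.1 hp)).and
    self_mem_nhdsWithin).exists
  have hs0 : 0 < s := hs0
  have := hS _ hs
  rw [map_add, map_smul, smul_eq_mul] at this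
  nlinarith [mul_pos hs0 hw]

lemma coord_lt_of_mem_interior {S : Set ℂ} {a : ℝ} {i : Fin 3} (hS : ∀ z ∈ S, coord z i ≤ a) {p : ℂ}
    (hp : p ∈ interior S) : coord p i < a :=
  lt_of_mem_interior (f := (LinearMap.proj i).comp coord) hS (w := v i)
    (by simp [coord_v]) hp

lemma lt_coord_of_mem_interior {S : Set ℂ} {a : ℝ} {i : Fin 3} (hS : ∀ z ∈ S, a ≤ coord z i) {p : ℂ}
    (hp : p ∈ interior S) : a < coord p i := by
  have := lt_of_mem_interior (f := -(LinearMap.proj i).comp coord) (a := -a)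
    (fun z hz => by simpa using hS z hz) (w := -v i) (by simp [coord_v]) hp
  simpa using this

lemma convex_coord_le (i : Fin 3) (a : ℝ) : Convex ℝ {z : ℂ | coord z i ≤ a} :=
  convex_halfSpace_le ((LinearMap.proj i).comp coord).isLinear a

lemma convex_le_coord (i : Fin 3) (a : ℝ) : Convex ℝ {z : ℂ | a ≤ coord z i} :=
  convex_halfSpace_ge ((LinearMap.proj i).comp coord).isLinear a

lemma coord_mem_of_mem_hexagon {c z : ℂ} (hz : z ∈ hexagon c) (i : Fin 3) :
    coord c i - 1 ≤ coord z i ∧ coord z i ≤ coord c i + 1 := by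
  have hv : ∀ k, -1 ≤ coord (v k) i ∧ coord (v k) i ≤ 1 := by
    intro k
    rw [coord_v]
    split_ifs <;> norm_num
  have hsub : hexagon c ⊆ {z | coord c i - 1 ≤ coord z i} ∩ {z | coord z i ≤ coord c i + 1} := by
    refine convexHull_min ?_ ((convex_le_coord i _).inter (convex_coord_le i _))
    rintro _ (⟨k, rfl⟩ | ⟨k, rfl⟩)
    · have := hv k
      simp only [mem_inter_iff, mem_ofPred_eq, map_add, Pi.add_apply]
      constructor <;> linarith
    · have := hv k
      simp only [mem_inter_iff, mem_ofPred_eq, map_sub, Pi.sub_apply]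
      constructor <;> linarith
  exact hsub hz

lemma inHex_of_mem_interior {c z : ℂ} {k : Fin 3 → ℤ} (hk : k 0 + k 1 + k 2 = 0)
    (hc : coord c = shift k) (hz : z ∈ interior (hexagon c)) : InHex k (coord z) := by
  refine ⟨hk, fun i => abs_lt.2 ?_⟩
  have h1 := lt_coord_of_mem_interior (fun w hw => (coord_mem_of_mem_hexagon hw i).1) hz
  have h2 := coord_lt_of_mem_interior (fun w hw => (coord_mem_of_mem_hexagon hw i).2) hz
  rw [hc] at h1 h2
  simp only [shift] at h1 h2
  constructor <;> linarith

/-- The inequalities that hold on the triangle behind the side of a hexagon where the coordinate `a`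
is largest, or smallest. -/
lemma coord_mem_of_mem_triangle (c : ℂ) {i j : Fin 3} (hij : i ≠ j) : ∃ a : Fin 3,
    ((∀ z ∈ triangle c i j, coord c a + 1 ≤ coord z a) ∧
      ∀ b, b ≠ a → ∀ z ∈ triangle c i j, coord c b - 1 ≤ coord z b) ∨
    ((∀ z ∈ triangle c i j, coord z a ≤ coord c a - 1) ∧
      ∀ b, b ≠ a → ∀ z ∈ triangle c i j, coord z b ≤ coord c b + 1) := by
  have hle : ∀ b x, coord (v i) b ≤ x → -coord (v j) b ≤ x → coord (v i) b - coord (v j) b ≤ x →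
      ∀ z ∈ triangle c i j, coord z b ≤ coord c b + x := by
    intro b x h1 h2 h3 z hz
    refine (convexHull_min ?_ (convex_coord_le b _)) hz
    rintro _ (rfl | rfl | rfl)
    · simp only [mem_ofPred_eq, map_add, Pi.add_apply]; linarith
    · simp only [mem_ofPred_eq, map_sub, Pi.sub_apply]; linarith
    · simp only [mem_ofPred_eq, map_sub, map_add, Pi.sub_apply, Pi.add_apply]; linarith
  have hge : ∀ b x, x ≤ coord (v i) b → x ≤ -coord (v j) b → x ≤ coord (v i) b - coord (v j) b →
      ∀ z ∈ triangle c i j, coord c b + x ≤ coord z b := by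
    intro b x h1 h2 h3 z hz
    refine (convexHull_min ?_ (convex_le_coord b _)) hz
    rintro _ (rfl | rfl | rfl)
    · simp only [mem_ofPred_eq, map_add, Pi.add_apply]; linarith
    · simp only [mem_ofPred_eq, map_sub, Pi.sub_apply]; linarith
    · simp only [mem_ofPred_eq, map_sub, map_add, Pi.sub_apply, Pi.add_apply]; linarith
  have hcase : ∀ i j : Fin 3, i ≠ j → j = i + 1 ∨ i = j + 1 := by decide
  have hother : ∀ a b : Fin 3, b ≠ a → b = a + 1 ∨ b = a + 2 := by decide
  rcases hcase i j hij with rfl | rfl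
  · refine ⟨i, Or.inl ⟨hge i 1 ?_ ?_ ?_, fun b hb => ?_⟩⟩
    · rw [coord_v_self]
    · rw [coord_v_succ_self]; norm_num
    · rw [coord_v_self, coord_v_succ_self]; norm_num
    · simp only [sub_eq_add_neg]
      rcases hother i b hb with rfl | rfl
      · apply hge <;> (try rw [coord_v_self]) <;> (try rw [coord_v_succ]) <;> norm_num
      · apply hge <;> (try rw [coord_v_add_two]) <;> (try rw [coord_v_succ_add_two]) <;> norm_num
  · refine ⟨j, Or.inr ⟨?_, fun b hb => ?_⟩⟩
    · simp only [sub_eq_add_neg]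
      apply hle <;> (try rw [coord_v_succ_self]) <;> (try rw [coord_v_self])
      all_goals norm_num
    · rcases hother j b hb with rfl | rfl
      · apply hle <;> (try rw [coord_v_self]) <;> (try rw [coord_v_succ]) <;> norm_num
      · apply hle <;> (try rw [coord_v_succ_add_two]) <;> (try rw [coord_v_add_two]) <;> norm_num

/-- Inside a triangle no coordinate is an odd integer, and the triangle meets no hexagon. -/
lemma not_odd_of_mem_triangle {c z : ℂ} {k : Fin 3 → ℤ} {i j : Fin 3} (hij : i ≠ j)
    (hk : k 0 + k 1 + k 2 = 0) (hc : coord c = shift k) (hz : z ∈ interior (triangle c i j)) :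
    (∀ i, ¬ IsOddInt (coord z i)) ∧ ∀ l, ¬ InHex l (coord z) := by
  -- It is enough to find integers near the halved coordinates whose sum is not zero.
  have key : ∀ l : Fin 3 → ℤ, l 0 + l 1 + l 2 ≠ 0 → (∀ i, |coord z i - 2 * l i| < 1) →
      (∀ i, ¬ IsOddInt (coord z i)) ∧ ∀ l, ¬ InHex l (coord z) := by
    intro l hl h
    refine ⟨fun i => not_isOddInt_of_abs_lt (h i), fun l' h' => hl ?_⟩
    have := h'.1
    rwa [eq_of_abs_sub_lt_one (h'.2 0) (h 0), eq_of_abs_sub_lt_one (h'.2 1) (h 1),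
      eq_of_abs_sub_lt_one (h'.2 2) (h 2)] at this
  have hk' : (k 0 + k 1 + k 2 : ℝ) = 0 := by exact_mod_cast hk
  have hs := coord_sum z
  obtain ⟨a, ⟨h1, h2⟩ | ⟨h1, h2⟩⟩ := coord_mem_of_mem_triangle c hij
  · have h1 := lt_coord_of_mem_interior h1 hz
    have h2 : ∀ b, b ≠ a → _ := fun b hb => lt_coord_of_mem_interior (h2 b hb) hz
    simp only [hc, shift] at h1 h2
    refine key (fun b => k b + if b = a then 1 else 0) ?_ fun b => abs_lt.2 ?_
    · fin_cases a <;> simp <;> omega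
    · have h20 := h2 0
      have h21 := h2 1
      have h22 := h2 2
      fin_cases a <;> fin_cases b <;> simp at h1 h20 h21 h22 ⊢ <;> constructor <;> linarith
  · have h1 := coord_lt_of_mem_interior h1 hz
    have h2 : ∀ b, b ≠ a → _ := fun b hb => coord_lt_of_mem_interior (h2 b hb) hz
    simp only [hc, shift] at h1 h2
    refine key (fun b => k b - if b = a then 1 else 0) ?_ fun b => abs_lt.2 ?_
    · fin_cases a <;> simp <;> omega
    · have h20 := h2 0
      have h21 := h2 1
      have h22 := h2 2
      fin_cases a <;> fin_cases b <;> simp at h1 h20 h21 h22 ⊢ <;> constructor <;> linarith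

lemma v_add_v_succ (i : Fin 3) : v i + v (i + 1) = -v (i + 2) := by
  apply coord_injective
  funext l
  rw [map_add, map_neg]
  fin_cases i <;> fin_cases l <;> simp [coord_v]

lemma edgeLine_eq {i j a : Fin 3} (h : v i + v j = -v a) :
    edgeLine i j = Submodule.span ℝ {v a} := by
  rw [edgeLine, h, ← Set.neg_singleton, Submodule.span_neg]

lemma norm_v (a : Fin 3) : ‖v a‖ = 1 := by
  have h3 := sqrt_three_mul_self
  rw [Complex.norm_def, Real.sqrt_eq_one, Complex.normSq_apply]
  fin_cases a <;> simp [v] <;> linarith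

lemma inner_v (a : Fin 3) (u : ℂ) : inner ℝ (v a) u = (coord u a - coord u (a + 2)) / 2 := by
  have h3 := sqrt_three_mul_self
  have hne := sqrt_three_ne_zero
  rw [Complex.inner, Complex.mul_re, Complex.conj_re, Complex.conj_im]
  fin_cases a
  · simp [v, coord_zero, coord_two]
  · change _ = (coord u 1 - coord u 0) / 2
    simp [v, coord_zero, coord_one]
    field_simp
    linear_combination u.im * h3
  · change _ = (coord u 2 - coord u 1) / 2
    simp [v, coord_one, coord_two]
    field_simp
    linear_combination (-u.im) * h3

/-- The opposite of the reflection across the line spanned by `v a` exchanges the two coordinates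
other than the one that vanishes on that line. -/
lemma coord_neg_reflection {K : Submodule ℝ ℂ} [K.HasOrthogonalProjection] {a : Fin 3}
    (hK : K = Submodule.span ℝ {v a}) (u : ℂ) (l : Fin 3) :
    coord (-K.reflection u) l = coord u (2 * (a + 1) - l) := by
  subst hK
  rw [Submodule.reflection_apply, Submodule.starProjection_unit_singleton ℝ (norm_v a), inner_v,
    two_nsmul, map_neg, map_sub, map_add, map_smul]
  simp only [Pi.neg_apply, Pi.sub_apply, Pi.add_apply, Pi.smul_apply, smul_eq_mul]
  have hl : ∀ a l : Fin 3, l = a ∨ l = a + 1 ∨ l = a + 2 := by decide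
  have e1 : ∀ a : Fin 3, 2 * (a + 1) - a = a + 2 ∧ 2 * (a + 1) - (a + 1) = a + 1 ∧
      2 * (a + 1) - (a + 2) = a := by decide
  obtain ⟨e1, e2, e3⟩ := e1 a
  rcases hl a l with rfl | rfl | rfl
  · rw [coord_v_self, e1]; ring
  · rw [coord_v_succ, e2]; ring
  · rw [coord_v_add_two, e3]; ring

/-- On an open edge exactly one coordinate is an odd integer. -/
lemma exists_odd_of_mem_openEdge {c p : ℂ} {k : Fin 3 → ℤ} {i j : Fin 3} (hij : i ≠ j)
    (hc : coord c = shift k) (hp : p ∈ openEdge c i j) : ∃ a : Fin 3, v i + v j = -v a ∧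
      IsOddInt (coord p (a + 1)) ∧ ∀ b, b ≠ a + 1 → ¬ IsOddInt (coord p b) := by
  obtain ⟨x, y, hx, hy, hxy, rfl⟩ := hp
  have hcoord : ∀ b, coord (x • (c + v i) + y • (c - v j)) b =
      2 * k b + (x * coord (v i) b - y * coord (v j) b) := by
    intro b
    rw [map_add, map_smul, map_smul, map_add, map_sub, hc]
    simp only [Pi.add_apply, Pi.smul_apply, Pi.sub_apply, smul_eq_mul, shift]
    linear_combination (2 * (k b : ℝ)) * hxy
  have hcase : ∀ i j : Fin 3, i ≠ j → j = i + 1 ∨ i = j + 1 := by decide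
  have hother : ∀ a b : Fin 3, b ≠ a + 2 + 1 → b = a + 1 ∨ b = a + 2 := by decide
  have h3 : ∀ a : Fin 3, a + 2 + 1 = a := by decide
  rcases hcase i j hij with rfl | rfl
  · refine ⟨i + 2, v_add_v_succ i, ⟨k i, ?_⟩, fun b hb => ?_⟩
    · rw [h3, hcoord, coord_v_self, coord_v_succ_self]; linarith
    · apply not_isOddInt_of_abs_lt (a := k b)
      rw [hcoord, add_sub_cancel_left, abs_lt]
      rcases hother i b hb with rfl | rfl
      · rw [coord_v_self, coord_v_succ]; constructor <;> linarith
      · rw [coord_v_add_two, coord_v_succ_add_two]; constructor <;> linarith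
  · refine ⟨j + 2, by rw [add_comm, v_add_v_succ j], ⟨k j - 1, ?_⟩, fun b hb => ?_⟩
    · rw [h3, hcoord, coord_v_self, coord_v_succ_self]; push_cast; linarith
    · apply not_isOddInt_of_abs_lt (a := k b)
      rw [hcoord, add_sub_cancel_left, abs_lt]
      rcases hother j b hb with rfl | rfl
      · rw [coord_v_self, coord_v_succ]; constructor <;> linarith
      · rw [coord_v_add_two, coord_v_succ_add_two]; constructor <;> linarith

lemma mem_span_v_of_coord_eq_zero {a : Fin 3} {z : ℂ} (h : coord z (a + 1) = 0) :
    z ∈ Submodule.span ℝ {v a} := by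
  refine Submodule.mem_span_singleton.2 ⟨coord z a, coord_injective ?_⟩
  have hs := coord_sum z
  rw [map_smul]
  funext l
  fin_cases a <;> fin_cases l <;> simp [coord_v] at h ⊢ <;> linarith

/-- A trajectory in the plane follows the flow in coordinates. -/
lemma IsTrajectoryOn.flowsAt {I : Set ℝ} {γ : ℝ → ℂ × Circle} (h : IsTrajectoryOn I γ) {t : ℝ}
    (ht : t ∈ I) : FlowsAt (fun s => coord (γ s).1) (fun s => coord ((γ s).2 : ℂ)) t := by
  have hline : ∀ {u : Circle} {r : ℝ}, γ r = ((γ t).1 + ((r - t : ℝ) : ℂ) * (u : ℂ), u) →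
      coord (γ r).1 = coord (γ t).1 + (r - t) • coord (u : ℂ) ∧
        coord ((γ r).2 : ℂ) = coord (u : ℂ) := by
    intro u r hr
    rw [hr]
    refine ⟨?_, rfl⟩
    rw [← map_smul, ← map_add, Complex.real_smul]
  rcases h.step t ht with ⟨⟨R, hR, hp⟩, hs⟩ | ⟨c, hc, i, j, hij, hp, hd, hr, u, hu, hl⟩
  · refine ⟨coord ((γ t).2 : ℂ), ?_, ?_, Or.inl ⟨?_, rfl⟩⟩
    · exact (hs.filter_mono nhdsWithin_le_nhds).mono fun r hr => hline hr
    · exact (hs.filter_mono nhdsWithin_le_nhds).mono fun r hr => hline hr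
    · obtain ⟨c, hc, rfl | ⟨i, j, hij, rfl⟩⟩ := hR
      · obtain ⟨k, hk, hck⟩ := mem_centers_iff.1 hc
        exact (inHex_of_mem_interior hk hck hp).not_odd
      · obtain ⟨k, hk, hck⟩ := mem_centers_iff.1 hc
        exact (not_odd_of_mem_triangle hij hk hck hp).1
  · obtain ⟨k, hk, hck⟩ := mem_centers_iff.1 hc
    obtain ⟨a, ha, hodd, hno⟩ := exists_odd_of_mem_openEdge hij hck hp
    rw [edgeLine_eq ha] at hd
    refine ⟨coord (u : ℂ), hr.mono fun r hr => hline hr, hl.mono fun r hr => hline hr,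
      Or.inr ⟨a + 1, hodd, hno, fun h0 => hd (mem_span_v_of_coord_eq_zero h0), fun l => ?_⟩⟩
    simp only
    rw [hu, coord_neg_reflection (edgeLine_eq ha), sub_sub_cancel]

lemma IsNonsingularTrajectory.isFlowLine {γ : ℝ → ℂ × Circle} (h : IsNonsingularTrajectory γ) :
    IsFlowLine (fun s => coord (γ s).1) (fun s => coord ((γ s).2 : ℂ)) := by
  refine ⟨fun t => coord_sum _, fun t => coord_sum _, fun t h0 => ?_, fun t => h.flowsAt (mem_univ t)⟩
  have : ((γ t).2 : ℂ) = 0 := coord_injective (by simpa using h0)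
  exact Circle.coe_ne_zero _ this

lemma eq_of_coord_eq {x y : ℂ × Circle} (h1 : coord x.1 = coord y.1)
    (h2 : coord (x.2 : ℂ) = coord (y.2 : ℂ)) : x = y :=
  Prod.ext (coord_injective h1) (Circle.ext (coord_injective h2))

/-- When a trajectory is in a hexagon according to its coordinates, it is in the interior of the
corresponding tile. -/
lemma IsNonsingularTrajectory.mem_interior {γ : ℝ → ℂ × Circle} (h : IsNonsingularTrajectory γ)
    {t : ℝ} {k : Fin 3 → ℤ} (ht : InHex k (coord (γ t).1)) :
    ∃ c ∈ centers, coord c = shift k ∧ (γ t).1 ∈ interior (hexagon c) := by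
  rcases h.step t (mem_univ t) with ⟨⟨R, ⟨c, hc, hR⟩, hp⟩, -⟩ | ⟨c, hc, i, j, hij, hp, -⟩
  · obtain ⟨k', hk', hck⟩ := mem_centers_iff.1 hc
    rcases hR with rfl | ⟨i, j, hij, rfl⟩
    · obtain rfl := ht.unique (inHex_of_mem_interior hk' hck hp)
      exact ⟨c, hc, hck, hp⟩
    · exact absurd ht ((not_odd_of_mem_triangle hij hk' hck hp).2 k)
  · obtain ⟨k', hk', hck⟩ := mem_centers_iff.1 hc
    obtain ⟨a, -, hodd, -⟩ := exists_odd_of_mem_openEdge hij hck hp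
    exact absurd hodd (ht.not_odd _)

/-! ### Rational directions -/

/-- In coordinates the hexagonal norm is the maximum norm. -/
lemma hexNorm_eq {w : ℂ} {N : ℝ} (hle : ∀ i, |coord w i| ≤ N) (hN : ∃ i, |coord w i| = N) :
    hexNorm w = N := by
  have hcoord : ∀ a b c : ℝ, coord (a • v 0 + b • v 1 + c • v 2) = ![a - b, b - c, c - a] := by
    intro a b c
    rw [map_add, map_add, map_smul, map_smul, map_smul, coord_v_zero, coord_v_one, coord_v_two]
    funext i
    fin_cases i <;> simp <;> ring
  have hs := coord_sum w
  refine IsLeast.csInf_eq ⟨?_, ?_⟩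
  · obtain ⟨i, hi⟩ := hN
    have h0 := hle 0
    have h1 := hle 1
    have h2 := hle 2
    have hrep : ∀ a b c : ℝ, a - b = coord w 0 → b - c = coord w 1 → |a| + |b| + |c| = N →
        ∃ a b c : ℝ, w = a • v 0 + b • v 1 + c • v 2 ∧ N = |a| + |b| + |c| := by
      intro a b c e0 e1 e2
      refine ⟨a, b, c, coord_injective ?_, e2.symm⟩
      rw [hcoord]
      funext l
      fin_cases l
      · exact e0.symm
      · exact e1.symm
      · change coord w 2 = c - a
        linarith
    -- The coefficient that vanishes is the median of the three.
    fin_cases i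
    · refine hrep (-coord w 2) (coord w 1) 0 (by linarith) (by ring) ?_
      simp only [Fin.zero_eta] at hi
      rw [abs_neg, abs_zero]
      rcases abs_cases (coord w 0) with ⟨a0, b0⟩ | ⟨a0, b0⟩ <;>
      rcases abs_cases (coord w 1) with ⟨a1, b1⟩ | ⟨a1, b1⟩ <;>
      rcases abs_cases (coord w 2) with ⟨a2, b2⟩ | ⟨a2, b2⟩ <;> linarith
    · refine hrep 0 (-coord w 0) (coord w 2) (by ring) (by linarith) ?_
      simp only [Fin.mk_one] at hi
      rw [abs_neg, abs_zero]
      rcases abs_cases (coord w 0) with ⟨a0, b0⟩ | ⟨a0, b0⟩ <;>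
      rcases abs_cases (coord w 1) with ⟨a1, b1⟩ | ⟨a1, b1⟩ <;>
      rcases abs_cases (coord w 2) with ⟨a2, b2⟩ | ⟨a2, b2⟩ <;> linarith
    · refine hrep (coord w 0) 0 (-coord w 1) (by ring) (by ring) ?_
      simp only [Fin.reduceFinMk] at hi
      rw [abs_neg, abs_zero]
      rcases abs_cases (coord w 0) with ⟨a0, b0⟩ | ⟨a0, b0⟩ <;>
      rcases abs_cases (coord w 1) with ⟨a1, b1⟩ | ⟨a1, b1⟩ <;>
      rcases abs_cases (coord w 2) with ⟨a2, b2⟩ | ⟨a2, b2⟩ <;> linarith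
  · rintro _ ⟨a, b, c, rfl, rfl⟩
    obtain ⟨i, rfl⟩ := hN
    rw [hcoord]
    have ha := abs_nonneg a
    have hb := abs_nonneg b
    have hc := abs_nonneg c
    have h0 := abs_sub a b
    have h1 := abs_sub b c
    have h2 := abs_sub c a
    fin_cases i <;> simp <;> linarith

lemma isRationalDir_of_visible {w : ℂ} (hw : w ∈ visible) {u : ℂ} (hu : u = w / (‖w‖ : ℂ)) :
    ∃ N : ℕ, hexNorm w = N ∧ IsRationalDir (coord u) N := by
  obtain ⟨hlat, hvis⟩ := hw
  obtain ⟨n, hn⟩ := mem_eisensteinLattice_iff.1 hlat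
  have hw0 : w ≠ 0 := by
    rintro rfl
    exact hvis (1 / 2) (by norm_num) (by norm_num) (by simp)
  obtain ⟨i, hi⟩ := Finite.exists_max fun i => (n i).natAbs
  have habs : ∀ j, |coord w j| = ((n j).natAbs : ℝ) := by
    intro j
    rw [hn, Nat.cast_natAbs, Int.cast_abs]
  refine ⟨(n i).natAbs, hexNorm_eq (fun j => ?_) ⟨i, habs i⟩, ‖w‖⁻¹, by positivity, n, fun j => ?_,
    fun g hg => ?_, fun j => ?_, i, ?_⟩
  · rw [habs]
    exact_mod_cast hi j
  · have : u = ‖w‖⁻¹ • w := by rw [hu, Complex.real_smul]; push_cast; ring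
    rw [this, map_smul, Pi.smul_apply, smul_eq_mul, hn]
  · by_contra hunit
    choose f hf using hg
    have hg0 : g ≠ 0 := by
      rintro rfl
      refine hw0 (coord_injective ?_)
      funext j
      rw [hn, hf]
      simp
    have hg1 : 1 < |g| := by
      rw [Int.isUnit_iff_abs_eq] at hunit
      have := Int.one_le_abs hg0
      omega
    have hg1' : (1 : ℝ) < |(g : ℝ)| := by exact_mod_cast hg1
    have hgpos : 0 < |(g : ℝ)| := by linarith
    obtain ⟨e, he⟩ : |g| ∣ g := (abs_dvd g g).2 dvd_rfl
    refine hvis (|(g : ℝ)|⁻¹) (by positivity) (inv_lt_one_of_one_lt₀ hg1')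
      (mem_eisensteinLattice_iff.2 ⟨fun j => e * f j, fun j => ?_⟩)
    rw [← Complex.real_smul, map_smul, Pi.smul_apply, smul_eq_mul, hn, hf]
    rw [inv_mul_eq_iff_eq_mul₀ hgpos.ne']
    have : (g : ℝ) = |(g : ℝ)| * e := by exact_mod_cast he
    push_cast
    conv_lhs => rw [this]
    ring
  · rw [Int.abs_eq_natAbs]
    exact_mod_cast hi j
  · rw [Int.abs_eq_natAbs]

lemma IsRationalDir.exists_visible {u : Circle} {N : ℕ} (h : IsRationalDir (coord (u : ℂ)) N) :
    ∃ w ∈ visible, hexNorm w = N ∧ (u : ℂ) = w / (‖w‖ : ℂ) := by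
  obtain ⟨r, hr, n, hn, hprim, hle, hN⟩ := h
  set w : ℂ := r⁻¹ • (u : ℂ) with hw
  have hcw : ∀ i, coord w i = n i := by
    intro i
    rw [hw, map_smul, Pi.smul_apply, hn, smul_eq_mul]
    field_simp
  have hsum : n 0 + n 1 + n 2 = 0 := by
    have := coord_sum w
    rw [hcw, hcw, hcw] at this
    exact_mod_cast this
  refine ⟨w, ⟨mem_eisensteinLattice_iff.2 ⟨n, hcw⟩, fun c hc0 hc1 hc => ?_⟩,
    hexNorm_eq (fun i => ?_) ?_, ?_⟩
  · obtain ⟨l, hl⟩ := mem_eisensteinLattice_iff.1 hc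
    have hcl : ∀ i, c * n i = l i := by
      intro i
      rw [← hl i, ← Complex.real_smul, map_smul, Pi.smul_apply, smul_eq_mul, hcw]
    have hcop : IsCoprime (n 0) (n 1) := by
      rw [Int.isCoprime_iff_gcd_eq_one]
      have a0 : ((Int.gcd (n 0) (n 1) : ℕ) : ℤ) ∣ n 0 := Int.gcd_dvd_left ..
      have a1 : ((Int.gcd (n 0) (n 1) : ℕ) : ℤ) ∣ n 1 := Int.gcd_dvd_right ..
      have := hprim (Int.gcd (n 0) (n 1)) fun i => by
        fin_cases i
        · exact a0
        · exact a1
        · have a2 := dvd_neg.2 (dvd_add a0 a1)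
          have : n 2 = -(n 0 + n 1) := by omega
          simpa [this] using a2
      rw [Int.isUnit_iff] at this
      omega
    -- By Bézout's identity, `c` is an integer.
    obtain ⟨a, b, hab⟩ := hcop
    have hab' : (a * n 0 + b * n 1 : ℝ) = 1 := by exact_mod_cast hab
    have hc : c = ((a * l 0 + b * l 1 : ℤ) : ℝ) := by
      push_cast
      rw [← hcl, ← hcl]
      linear_combination (-c) * hab'
    rw [hc] at hc0 hc1
    have h1 : 0 < a * l 0 + b * l 1 := by exact_mod_cast hc0
    have h2 : a * l 0 + b * l 1 < 1 := by exact_mod_cast hc1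
    omega
  · rw [hcw]
    exact_mod_cast hle i
  · obtain ⟨i, hi⟩ := hN
    refine ⟨i, ?_⟩
    rw [hcw]
    exact_mod_cast hi
  · have hnorm : ‖w‖ = r⁻¹ := by
      rw [hw, norm_smul, Circle.norm_coe, mul_one, Real.norm_of_nonneg (by positivity)]
    rw [hnorm, hw, Complex.real_smul]
    have : (r : ℂ) ≠ 0 := by exact_mod_cast hr.ne'
    push_cast
    field_simp

lemma exists_eq_three_mul_iff {N : ℕ} {x : ℝ} (hx : x = N) : (∃ k : ℤ, x = 3 * k) ↔ 3 ∣ N := by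
  subst hx
  constructor
  · rintro ⟨k, hk⟩
    have hk : (N : ℤ) = 3 * k := by exact_mod_cast hk
    omega
  · rintro ⟨k, rfl⟩
    exact ⟨k, by push_cast; ring⟩

lemma mem_periodicDirections_iff {θ : Circle} :
    θ ∈ periodicDirections ↔ ∃ N, IsRationalDir (coord (θ : ℂ)) N ∧ ¬ 3 ∣ N := by
  constructor
  · rintro ⟨w, hw, h3, hθ⟩
    obtain ⟨N, hN, hrat⟩ := isRationalDir_of_visible hw hθ
    exact ⟨N, hrat, by rwa [exists_eq_three_mul_iff hN] at h3⟩
  · rintro ⟨N, hrat, h3⟩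
    obtain ⟨w, hw, hN, hθ⟩ := hrat.exists_visible
    exact ⟨w, hw, by rwa [exists_eq_three_mul_iff hN], hθ⟩

lemma mem_driftDirections_iff {θ : Circle} :
    θ ∈ driftDirections ↔ ∃ N, IsRationalDir (coord (θ : ℂ)) N ∧ 3 ∣ N := by
  constructor
  · rintro ⟨w, hw, h3, hθ⟩
    obtain ⟨N, hN, hrat⟩ := isRationalDir_of_visible hw hθ
    exact ⟨N, hrat, by rwa [exists_eq_three_mul_iff hN] at h3⟩
  · rintro ⟨N, hrat, h3⟩
    obtain ⟨w, hw, hN, hθ⟩ := hrat.exists_visible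
    exact ⟨w, hw, by rwa [exists_eq_three_mul_iff hN], hθ⟩

/-! ### Translations -/

lemma image_add_convexHull (S : Set ℂ) (τ : ℂ) :
    (fun z => z + τ) '' convexHull ℝ S = convexHull ℝ ((fun z => z + τ) '' S) :=
  (AffineMap.id ℝ ℂ + AffineMap.const ℝ ℂ τ).image_convexHull S

lemma image_add_hexagon (c τ : ℂ) : (fun z => z + τ) '' hexagon c = hexagon (c + τ) := by
  have h1 : ((fun z => z + τ) ∘ fun i => c + v i) = fun i => c + τ + v i :=
    funext fun i => add_right_comm c (v i) τ
  have h2 : ((fun z => z + τ) ∘ fun i => c - v i) = fun i => c + τ - v i :=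
    funext fun i => sub_add_eq_add_sub c (v i) τ
  rw [hexagon, hexagon, image_add_convexHull, image_union, ← range_comp, ← range_comp, h1, h2]

lemma image_add_triangle (c τ : ℂ) (i j : Fin 3) :
    (fun z => z + τ) '' triangle c i j = triangle (c + τ) i j := by
  rw [triangle, triangle, image_add_convexHull, image_insert_eq, image_insert_eq, image_singleton,
    add_right_comm c (v i) τ, sub_add_eq_add_sub, sub_add_eq_add_sub, add_right_comm c (v i) τ]

lemma add_mem_centers {c τ : ℂ} (hc : c ∈ centers) (hτ : τ ∈ centers) : c + τ ∈ centers := by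
  obtain ⟨l, hl, rfl⟩ := hc
  obtain ⟨l', hl', rfl⟩ := hτ
  exact ⟨l + l', add_mem hl hl', by ring⟩

lemma isTranslationSymmetry_of_mem_centers {τ : ℂ} (hτ : τ ∈ centers) :
    IsTranslationSymmetry τ := by
  have key : ∀ τ ∈ centers, ∀ R ∈ tiles, (fun z => z + τ) '' R ∈ tiles := by
    rintro τ hτ _ ⟨c, hc, rfl | ⟨i, j, hij, rfl⟩⟩
    · exact ⟨c + τ, add_mem_centers hc hτ, Or.inl (image_add_hexagon c τ)⟩
    · exact ⟨c + τ, add_mem_centers hc hτ, Or.inr ⟨i, j, hij, image_add_triangle c τ i j⟩⟩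
  have hneg : -τ ∈ centers := by
    obtain ⟨l, hl, rfl⟩ := hτ
    exact ⟨-l, neg_mem hl, by ring⟩
  refine Subset.antisymm ?_ fun R hR => ⟨_, key _ hneg R hR, ?_⟩
  · rintro _ ⟨R, hR, rfl⟩
    exact key τ hτ R hR
  · rw [← image_comp]
    have : ((fun z : ℂ => z + τ) ∘ fun z => z + -τ) = id := funext fun z => neg_add_cancel_right z τ
    rw [this, image_id]

/-- A translation that maps tiles to tiles maps the hexagon around the origin, which is too wide to
fit into a triangle, to a hexagon. -/
lemma mem_centers_of_isTranslationSymmetry {τ : ℂ} (hτ : IsTranslationSymmetry τ) :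
    τ ∈ centers := by
  have h0 : (0 : ℂ) ∈ centers := ⟨0, zero_mem _, by simp⟩
  have hmem : hexagon τ ∈ tiles := by
    rw [← hτ, ← zero_add τ, ← image_add_hexagon, zero_add]
    exact ⟨_, ⟨0, h0, Or.inl rfl⟩, rfl⟩
  have hplus : ∀ i, τ + v i ∈ hexagon τ := fun i =>
    subset_convexHull ℝ _ (Or.inl ⟨i, rfl⟩)
  have hminus : ∀ i, τ - v i ∈ hexagon τ := fun i =>
    subset_convexHull ℝ _ (Or.inr ⟨i, rfl⟩)
  obtain ⟨c, hc, hR | ⟨i, j, hij, hR⟩⟩ := hmem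
  · have : τ = c := by
      apply coord_injective
      funext i
      have h1 := hplus i
      have h2 := hminus i
      rw [hR] at h1 h2
      have h1 := (coord_mem_of_mem_hexagon h1 i).2
      have h2 := (coord_mem_of_mem_hexagon h2 i).1
      simp only [map_add, map_sub, Pi.add_apply, Pi.sub_apply, coord_v_self] at h1 h2
      linarith
    rwa [this]
  · exfalso
    have hsum : ∀ (z : ℂ) (a : Fin 3), coord z a + coord z (a + 1) + coord z (a + 2) = 0 := by
      intro z a
      have := coord_sum z
      fin_cases a <;> simp <;> linarith
    have hne : ∀ a : Fin 3, a + 1 ≠ a ∧ a + 2 ≠ a := by decide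
    obtain ⟨a, ⟨h1, h2⟩ | ⟨h1, h2⟩⟩ := coord_mem_of_mem_triangle c hij
    all_goals
      rw [← hR] at h1 h2
      have p1 := h1 _ (hplus a)
      have m1 := h1 _ (hminus a)
      have p2 := h2 _ (hne a).1 _ (hplus a)
      have m2 := h2 _ (hne a).1 _ (hminus a)
      have p3 := h2 _ (hne a).2 _ (hplus a)
      have m3 := h2 _ (hne a).2 _ (hminus a)
      have s1 := hsum τ a
      have s2 := hsum c a
      simp only [map_add, map_sub, Pi.add_apply, Pi.sub_apply, coord_v_self, coord_v_succ,
        coord_v_add_two] at p1 p2 p3 m1 m2 m3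
      linarith

/-! ### Trajectories in the plane -/

lemma IsNonsingularTrajectory.comp_add {γ : ℝ → ℂ × Circle} (h : IsNonsingularTrajectory γ)
    (P : ℝ) : IsNonsingularTrajectory fun s => γ (s + P) := by
  refine ⟨isOpen_univ, ordConnected_univ, fun t _ => ?_⟩
  have hcont : Tendsto (fun s => s + P) (𝓝 t) (𝓝 (t + P)) :=
    (continuous_id.add continuous_const).tendsto t
  have hge : Tendsto (fun s => s + P) (𝓝[≥] t) (𝓝[≥] (t + P)) :=
    tendsto_nhdsWithin_iff.2 ⟨hcont.mono_left nhdsWithin_le_nhds,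
      eventually_mem_nhdsWithin.mono fun s hs => add_le_add_left (mem_Ici.1 hs) P⟩
  have hlt : Tendsto (fun s => s + P) (𝓝[<] t) (𝓝[<] (t + P)) :=
    tendsto_nhdsWithin_iff.2 ⟨hcont.mono_left nhdsWithin_le_nhds,
      eventually_mem_nhdsWithin.mono fun s hs => add_lt_add_left (mem_Iio.1 hs) P⟩
  rcases h.step (t + P) (mem_univ _) with ⟨hR, hs⟩ | ⟨c, hc, i, j, hij, hp, hd, hr, u, hu, hl⟩
  · refine Or.inl ⟨hR, (hcont.eventually hs).mono fun r hr => ?_⟩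
    rwa [add_sub_add_right_eq_sub] at hr
  · refine Or.inr ⟨c, hc, i, j, hij, hp, hd, (hge.eventually hr).mono fun r hr => ?_, u, hu,
      (hlt.eventually hl).mono fun r hr => ?_⟩
    · rwa [add_sub_add_right_eq_sub] at hr
    · rwa [add_sub_add_right_eq_sub] at hr

/-- A trajectory lies in an invariant set if its directions and its momenta in the hexagons are the
right ones. -/
lemma range_subset_X {γ : ℝ → ℂ × Circle} (h : IsNonsingularTrajectory γ) {θ : Circle} {s : ℤˣ}
    (hγ : ∀ t l, InHex l (coord (γ t).1) → (∃ j, ∀ i, coord ((γ t).2 : ℂ) i = coord (θ : ℂ) (i + j)) ∧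
      0 < ((s : ℤ) : ℝ) * momentum l (coord (γ t).1) (coord ((γ t).2 : ℂ))) :
    range γ ⊆ X θ s := by
  rintro _ ⟨t₁, rfl⟩
  refine ⟨⟨univ, fun t => γ (t + t₁), h.comp_add t₁, mem_univ _, by simp⟩, ?_⟩
  intro I γ' h' h0 heq t ht c hc hin
  obtain ⟨e1, e2⟩ := flow_unique h'.ordConnected (fun s hs => h'.flowsAt hs)
    (fun s _ => (h.comp_add t₁).flowsAt (mem_univ s)) h0 (by simp [heq]) (by simp [heq]) ht
  have heq : γ' t = γ (t + t₁) := eq_of_coord_eq e1 e2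
  rw [heq] at hin ⊢
  obtain ⟨k, hk, hck⟩ := mem_centers_iff.1 hc
  obtain ⟨⟨j, hj⟩, hm⟩ := hγ _ k (inHex_of_mem_interior hk hck hin)
  refine ⟨⟨-j, coord_injective (funext fun i => ?_)⟩, ?_⟩
  · rw [hj, coord_v_mul, sub_neg_eq_add]
  · have hcross := cross_eq_coord ((γ (t + t₁)).1 - c) ((γ (t + t₁)).2 : ℂ)
    rw [map_sub, hck] at hcross
    have hpos := mul_pos (show 0 < √3 / 2 by positivity) hm
    rw [mul_left_comm] at hpos
    exact lt_of_lt_of_eq hpos (congrArg _ hcross.symm)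

/-- A trajectory that starts in an invariant set is, at some time, in a hexagon, with one of the
directions of the invariant set. -/
lemma IsNonsingularTrajectory.exists_dir_eq {γ : ℝ → ℂ × Circle} (h : IsNonsingularTrajectory γ)
    {θ : Circle} {s : ℤˣ} (h0 : γ 0 ∈ X θ s) : ∃ t k, InHex k (coord (γ t).1) ∧
      ∃ j : Fin 3, ∀ i, coord ((γ t).2 : ℂ) i = coord (θ : ℂ) (i - j) := by
  obtain ⟨t, k, hk⟩ := h.isFlowLine.exists_inHex
  obtain ⟨c, hc, -, hin⟩ := h.mem_interior hk
  obtain ⟨⟨j, hj⟩, -⟩ := h0.2 univ γ h (mem_univ _) rfl t (mem_univ _) c hc hin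
  exact ⟨t, k, hk, j, fun i => by rw [hj, coord_v_mul]⟩

lemma IsNonsingularTrajectory.exists_translatedBy {γ : ℝ → ℂ × Circle}
    (h : IsNonsingularTrajectory γ) {θ : Circle} {s : ℤˣ} (h0 : γ 0 ∈ X θ s) {N : ℕ}
    (hN : IsRationalDir (coord (θ : ℂ)) N) : ∃ P > 0, ∃ κ : Fin 3 → ℤ,
      IsTranslatedBy (fun s => coord (γ s).1) (fun s => coord ((γ s).2 : ℂ)) P κ ∧
      (κ = 0 ↔ ¬ 3 ∣ N) := by
  obtain ⟨t, k, hk, j, hj⟩ := h.exists_dir_eq h0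
  refine h.isFlowLine.exists_translatedBy hk ?_
  have := hN.comp_perm (Equiv.subRight j)
  convert this using 1
  funext i
  exact hj i

/-- A recurrent trajectory lies in the invariant set of the direction in which it crosses some
hexagon. -/
lemma IsNonsingularTrajectory.exists_subset_X {γ : ℝ → ℂ × Circle}
    (h : IsNonsingularTrajectory γ) {P : ℝ} (hP0 : 0 < P) {κ : Fin 3 → ℤ}
    (hP : IsTranslatedBy (fun s => coord (γ s).1) (fun s => coord ((γ s).2 : ℂ)) P κ) :
    ∃ θ : Circle, (∃ N, IsRationalDir (coord (θ : ℂ)) N ∧ (κ = 0 ↔ ¬ 3 ∣ N)) ∧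
      ∃ s : ℤˣ, range γ ⊆ X θ s := by
  obtain ⟨t, k, hk⟩ := h.isFlowLine.exists_inHex
  obtain ⟨hN, hX⟩ := h.isFlowLine.isRationalDir_of_translatedBy hk hP0 hP
  refine ⟨(γ t).2, hN, ?_⟩
  have hpos := (hX t k hk).2
  rcases lt_or_ge 0 (momentum k (coord (γ t).1) (coord ((γ t).2 : ℂ))) with hm | hm
  · refine ⟨1, range_subset_X h fun s l hl => ⟨(hX s l hl).1, ?_⟩⟩
    simpa using pos_of_mul_pos_left (hX s l hl).2 hm.le
  · refine ⟨-1, range_subset_X h fun s l hl => ⟨(hX s l hl).1, ?_⟩⟩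
    have := neg_of_mul_pos_left (hX s l hl).2 hm
    simpa using this

/-! ### Periodic and drift-periodic trajectories -/

theorem completelyPeriodic {θ : Circle} (hθ : θ ∈ periodicDirections) (s : ℤˣ) :
    CompletelyPeriodic θ s := by
  intro γ h h0
  obtain ⟨N, hN, h3⟩ := mem_periodicDirections_iff.1 hθ
  obtain ⟨P, hP0, κ, hP, hκ⟩ := h.exists_translatedBy h0 hN
  obtain rfl := hκ.2 h3
  refine ⟨h, P, hP0, fun t => eq_of_coord_eq ?_ (hP t).2⟩
  simpa [shift_zero] using (hP t).1

theorem IsPeriodicTrajectory.exists_subset_X {γ : ℝ → ℂ × Circle} (hγ : IsPeriodicTrajectory γ) :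
    ∃ θ ∈ periodicDirections, ∃ s : ℤˣ, range γ ⊆ X θ s := by
  obtain ⟨h, P, hP0, hP⟩ := hγ
  obtain ⟨θ, ⟨N, hN, hκ⟩, hs⟩ := h.exists_subset_X hP0 (κ := 0)
    fun t => by simp [hP t, shift_zero]
  exact ⟨θ, mem_periodicDirections_iff.2 ⟨N, hN, hκ.1 rfl⟩, hs⟩

theorem completelyDriftPeriodic {θ : Circle} (hθ : θ ∈ driftDirections) (s : ℤˣ) :
    CompletelyDriftPeriodic θ s := by
  intro γ h h0
  obtain ⟨N, hN, h3⟩ := mem_driftDirections_iff.1 hθ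
  obtain ⟨P, hP0, κ, hP, hκ⟩ := h.exists_translatedBy h0 hN
  have hκ0 : κ ≠ 0 := fun hc => hκ.1 hc h3
  obtain ⟨τ, hτ, hcτ⟩ := exists_center (hP.sum_eq_zero h.isFlowLine)
  have hper : ∀ t, γ (t + P) = ((γ t).1 + τ, (γ t).2) := fun t =>
    eq_of_coord_eq (by simpa [hcτ] using (hP t).1) (hP t).2
  refine ⟨h, τ, ?_, isTranslationSymmetry_of_mem_centers hτ, ?_⟩
  · rintro rfl
    refine hκ0 (funext fun i => ?_)
    have := congrFun hcτ i
    simpa [shift] using this.symm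
  · ext x
    constructor
    · rintro ⟨_, ⟨t, rfl⟩, rfl⟩
      exact ⟨t + P, hper t⟩
    · rintro ⟨t, rfl⟩
      refine ⟨_, ⟨t - P, rfl⟩, ?_⟩
      have := hper (t - P)
      rw [sub_add_cancel] at this
      exact this.symm

theorem IsDriftPeriodicTrajectory.exists_subset_X {γ : ℝ → ℂ × Circle}
    (hγ : IsDriftPeriodicTrajectory γ) : ∃ θ ∈ driftDirections, ∃ s : ℤˣ, range γ ⊆ X θ s := by
  obtain ⟨h, τ, hτ0, hτ, hrange⟩ := hγ
  obtain ⟨κ, -, hκ⟩ := mem_centers_iff.1 (mem_centers_of_isTranslationSymmetry hτ)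
  have hκ0 : κ ≠ 0 := by
    rintro rfl
    exact hτ0 (coord_injective (by rw [hκ, shift_zero, map_zero]))
  obtain ⟨t, ht⟩ : ((γ 0).1 + τ, (γ 0).2) ∈ Set.range γ := by
    rw [← hrange]
    exact ⟨γ 0, ⟨0, rfl⟩, rfl⟩
  have hq : coord (γ t).1 = coord (γ 0).1 + shift κ := by rw [ht, ← hκ, ← map_add]
  have hd : coord ((γ t).2 : ℂ) = coord ((γ 0).2 : ℂ) := by rw [ht]
  -- The translated point may come before or after the original one.
  obtain ⟨P, hP0, κ', hκ', hP⟩ : ∃ P > 0, ∃ κ' : Fin 3 → ℤ, κ' ≠ 0 ∧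
      IsTranslatedBy (fun s => coord (γ s).1) (fun s => coord ((γ s).2 : ℂ)) P κ' := by
    rcases lt_trichotomy t 0 with hlt | rfl | hgt
    · refine ⟨0 - t, by linarith, -κ, neg_ne_zero.2 hκ0, fun s => ?_⟩
      refine h.isFlowLine.recurrent ?_ hd.symm s
      simp only [hq, shift_neg]
      module
    · refine absurd (funext fun i => ?_) hκ0
      have := congrFun hq i
      simpa [shift] using this
    · exact ⟨t - 0, by linarith, κ, hκ0, fun s => h.isFlowLine.recurrent hq hd s⟩
  obtain ⟨θ, ⟨N, hN, h3⟩, hs⟩ := h.exists_subset_X hP0 hP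
  exact ⟨θ, mem_driftDirections_iff.2 ⟨N, hN, by_contra fun hc => hκ' (h3.2 hc)⟩, hs⟩

end Trihex

end

theorem theorem1p4 :
    ((∀ θ ∈ Trihex.periodicDirections, ∀ s : ℤˣ, Trihex.CompletelyPeriodic θ s) ∧
      (∀ γ : ℝ → ℂ × Circle, Trihex.IsPeriodicTrajectory γ →
        ∃ θ ∈ Trihex.periodicDirections, ∃ s : ℤˣ, Set.range γ ⊆ Trihex.X θ s)) ∧
    ((∀ θ ∈ Trihex.driftDirections, ∀ s : ℤˣ, Trihex.CompletelyDriftPeriodic θ s) ∧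
      (∀ γ : ℝ → ℂ × Circle, Trihex.IsDriftPeriodicTrajectory γ →
        ∃ θ ∈ Trihex.driftDirections, ∃ s : ℤˣ, Set.range γ ⊆ Trihex.X θ s)) :=
  ⟨⟨fun _ hθ s => Trihex.completelyPeriodic hθ s,
      fun _ hγ => Trihex.IsPeriodicTrajectory.exists_subset_X hγ⟩,
    fun _ hθ s => Trihex.completelyDriftPeriodic hθ s,
    fun _ hγ => Trihex.IsDriftPeriodicTrajectory.exists_subset_X hγ⟩
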